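/- Equip $S^5\subset\mathbb{C}^3=\mathbb{R}^6$ with the round metric and the canonical contact form $\alpha=\sum_{\ell=1}^3(x_{2\ell-1}\,dx_{2\ell}-x_{2\ell}\,dx_{2\ell-1})$, and let $\Pi:G\to S^5$ be the bundle of Legendrian planes (two-dimensional $\mathcal P\subset\ker\alpha_p\subset T_pS^5$ with $d\alpha|_{\mathcal P}=0$). For $F\in C^\infty(S^5)$ let $W_F$ be the Hamiltonian vector field $2W_F=J\nabla^HF+2F\,(ip)$, where $\nabla^H F$ is the projection of $\nabla F$ onto $\ker\alpha$ and $J$ is multiplication by $i$. A Hamiltonian stationary Legendrian varifold (HSLV) is a finite Borel measure $\mathbf v$ on $G$ with $\int_G\operatorname{div}_{\mathcal P}W_F\,d\mathbf v(\mathcal P,p)=0$ for all such $F$; varifolds converge, $\mathbf v_k\rightharpoonup\mathbf v$, if $\int\Phi\,d\mathbf v_k\to\int\Phi\,d\mathbf v$ for all $\Phi\in C(G)$. A varifold is rectifiable if it is a countable sum $\sum_i c_i\mathbf v(M_i)$, $c_i\ge0$, where $M_i$ is a Borel piece of a $C^1$ surface with Legendrian tangent planes and $\mathbf v(M_i)$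 is its multiplicity-one varifold; it is integral if one can take $c_i\in\mathbb N$. A map $u\in W^{1,2}\cap C^0(\Sigma,S^5)$ from a flat torus $\Sigma$, together with $N\in L^\infty(\Sigma,\mathbb N^*)$, is a parametrized HSLV (PHSLV) if $u$ is Legendrian and weakly conformal and, for every smooth $f:\Sigma\to[0,\infty)$ and a.e. $t>0$, $\int_{\{f>t\}}N\,\nabla(W_F\circ u)\cdot\nabla u\,dx^2=0$ for all $F\in C^\infty(S^5)$ vanishing near $u(f^{-1}(t))$; it induces the varifold $\mathbf v(B)=\int_{\{x:(\operatorname{img}\nabla u(x),u(x))\in B\}}N\frac{|\nabla u|^2}{2}\,dx^2$. **Theorem.** There exist a sequence of flat rectangular tori $T_{1,R_k}=\mathbb{R}^2/2\pi(\mathbb{Z}\oplus R_k\mathbb{Z})$, with $R_k>0$ and $R_k\to\infty$, and smooth conformal Hamiltonian stationary Legendrian embeddings $u_k:T_{1,R_k}\to S^5$ such that each $(T_{1,R_k},u_k,1)$ is a PHSLV, the varifold $\mathbf v_k$ that it induces is an integral HSLV, and $\mathbf v_k\rightharpoonup\mathbf v_\infty$, where $\mathbf v_\infty$ is a non-rectifiable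 HSLV. More precisely, let $\mathcal C=\{(0,0,e^{i\alpha}):\alpha\in\mathbb R/2\pi\mathbb Z\}$ (the Hopf fiber over $[0,0,1]$); then $$\mathbf v_\infty=2\pi\cdot\mu(e^{i\alpha})\otimes\mathcal H^1\llcorner\mathcal C\,(0,0,e^{i\alpha}),$$ where $\mu(e^{i\alpha})$ is the uniform probability measure on the torus of Legendrian planes $\{(e^{i\alpha})_*\mathcal P_{\tau,\eta}:(\tau,\eta)\in(\mathbb R/2\pi\mathbb Z)^2\}$ in $T_{(0,0,e^{i\alpha})}S^5$, with $\mathcal P_{\tau,\eta}=\operatorname{span}\{(\cos\tau)e_1+(\sin\tau)e_2,(\cos\eta)e_3+(\sin\eta)e_4\}\subset T_{(0,0,1)}S^5$, and $(e^{i\alpha})_*$ is the differential of $x\mapsto e^{i\alpha}x$. In particular no subsequence of $(\mathbf v_k)$ converges to a rectifiable varifold, so compactness fails for integral HSLVs and, when the conformal class degenerates, for varifolds induced by PHSLVs (which are rectifiable). -/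

import Mathlib

open Real Set Filter Topology MeasureTheory
open scoped ContDiff ENNReal NNReal

namespace HSL

noncomputable section

/-! ### The contact sphere `S⁵ ⊂ ℂ³` -/

/-- `ℂ³ = ℝ⁶` with its Euclidean norm; all inner products below are the real ones. -/
abbrev E : Type := EuclideanSpace ℂ (Fin 3)

/-- The canonical contact form `α = ∑ (x_{2ℓ-1} dx_{2ℓ} - x_{2ℓ} dx_{2ℓ-1})`, that is,
`α_p(w) = ⟨i p, w⟩`. -/
def contactForm (p w : E) : ℝ := inner ℝ (Complex.I • p) w

/-- A Legendrian plane at `p ∈ S⁵`: a two-dimensional real subspace of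
`ker α_p ⊂ T_p S⁵` on which `dα_p = 2⟨i ·, ·⟩` vanishes. -/
def IsLegendrianPlane (p : E) (P : Submodule ℝ E) : Prop :=
  Module.finrank ℝ P = 2 ∧
  (∀ w ∈ P, inner ℝ p w = 0 ∧ contactForm p w = 0) ∧
  ∀ w ∈ P, ∀ w' ∈ P, inner ℝ (Complex.I • w) w' = 0

/-- The Grassmannian bundle of Legendrian planes over `S⁵`. -/
@[ext]
structure LegGr where
  pt : E
  plane : Submodule ℝ E
  norm_pt : ‖pt‖ = 1
  legendrian : IsLegendrianPlane pt plane

/-- The usual topology of the Grassmannian bundle: a plane is identified with the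
orthogonal projection onto it. -/
instance : TopologicalSpace LegGr :=
  TopologicalSpace.induced
    (fun g => ((g.pt, g.plane.starProjection) : E × (E →L[ℝ] E))) inferInstance

instance : MeasurableSpace LegGr := borel LegGr

instance : BorelSpace LegGr := ⟨rfl⟩

/-! ### Hamiltonian vector fields and stationary varifolds -/

/-- The horizontal gradient: the orthogonal projection of `∇F(p)` onto `ker α_p ⊂ T_p S⁵`
(for `|p| = 1`); there it depends only on `F` restricted to `S⁵`. -/
def horGrad (F : E → ℝ) (p : E) : E :=
  gradient F p - (inner ℝ p (gradient F p) : ℝ) • p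
    - (inner ℝ (Complex.I • p) (gradient F p) : ℝ) • (Complex.I • p)

/-- The Hamiltonian (contact) vector field of `F` on `S⁵`:
`2 W_F = J ∇^H F + 2 F · (i p)`, normalized by `α(W_F) = F`.
A smooth function on `S⁵` is given as the restriction of a smooth function on `ℂ³`. -/
def hamField (F : E → ℝ) (p : E) : E :=
  (1 / 2 : ℝ) • (Complex.I • horGrad F p) + F p • (Complex.I • p)

/-- `div_P W = ∑ⱼ ⟨D_{Zⱼ} W, Zⱼ⟩` for an orthonormal basis `Z₁, Z₂` of `P`, as the trace of
`π_P ∘ DW(p)`. -/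
def divPlane (W : E → E) (P : Submodule ℝ E) (p : E) : ℝ :=
  LinearMap.trace ℝ E (P.starProjection ∘L fderiv ℝ W p : E →L[ℝ] E).toLinearMap

/-- Hamiltonian stationary Legendrian varifolds (HSLV) on `S⁵`. -/
def IsHSLV (v : Measure LegGr) : Prop :=
  IsFiniteMeasure v ∧
  ∀ F : E → ℝ, ContDiff ℝ ∞ F → ∫ g, divPlane (hamField F) g.plane g.pt ∂v = 0

/-- Convergence of varifolds on `S⁵`: weak convergence of Radon measures on the (compact)
bundle of Legendrian planes. -/
def VarifoldTendsto (v : ℕ → Measure LegGr) (w : Measure LegGr) : Prop :=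
  ∀ Φ : LegGr → ℝ, Continuous Φ →
    Tendsto (fun k => ∫ g, Φ g ∂(v k)) atTop (𝓝 (∫ g, Φ g ∂w))

/-! ### Rectifiable and integral varifolds -/

/-- The area element of a map from a planar domain with partial derivatives `a`, `b`. -/
def areaElement (a b : E) : ℝ := √(‖a‖ ^ 2 * ‖b‖ ^ 2 - (inner ℝ a b : ℝ) ^ 2)

/-- `v = ∑ cᵢ v(Mᵢ)`, where `Mᵢ = gᵢ(Aᵢ)` is an injectively parametrized measurable piece of a
`C¹` surface with Legendrian tangent planes, and `v(Mᵢ)` is the varifold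
`B ↦ ℋ²{x ∈ Mᵢ : (x, T_x Mᵢ) ∈ B}`, written by means of the area formula. -/
def IsSumOfPieces (c : ℕ → ℝ≥0) (v : Measure LegGr) : Prop :=
  ∃ (A : ℕ → Set (ℝ × ℝ)) (g : ℕ → ℝ × ℝ → E),
    (∀ i, MeasurableSet (A i) ∧ ContDiff ℝ 1 (g i) ∧ InjOn (g i) (A i) ∧
      ∀ z ∈ A i, ‖g i z‖ = 1 ∧
        IsLegendrianPlane (g i z) (LinearMap.range (fderiv ℝ (g i) z).toLinearMap)) ∧
    ∀ B : Set LegGr, MeasurableSet B →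
      v B = ∑' i, (c i : ℝ≥0∞) *
        ∫⁻ z in {z ∈ A i | ∃ b ∈ B, b.pt = g i z ∧
            b.plane = LinearMap.range (fderiv ℝ (g i) z).toLinearMap},
          ENNReal.ofReal (areaElement (fderiv ℝ (g i) z (1, 0)) (fderiv ℝ (g i) z (0, 1)))

/-- Rectifiable (two-dimensional, Legendrian) varifolds in `S⁵`. -/
def IsRectifiableVarifold (v : Measure LegGr) : Prop :=
  ∃ c : ℕ → ℝ≥0, IsSumOfPieces c v

/-- Integral varifolds: rectifiable with integer multiplicity. -/
def IsIntegralVarifold (v : Measure LegGr) : Prop :=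
  ∃ m : ℕ → ℕ, IsSumOfPieces (fun i => (m i : ℝ≥0)) v

/-! ### Maps from flat tori -/

/-- The flat rectangular torus `T_{1,R} = ℝ² / 2π(ℤ ⊕ Rℤ)`. -/
abbrev Torus (R : ℝ) : Type := AddCircle (2 * π) × AddCircle (2 * π * R)

/-- The covering map `ℝ² → T_{1,R}`. -/
def Torus.mk (R : ℝ) (z : ℝ × ℝ) : Torus R := (↑z.1, ↑z.2)

/-- The area measure of the flat torus `T_{1,R}`. -/
def Torus.area (R : ℝ) : Measure (Torus R) :=
  Measure.map (Torus.mk R) (volume.restrict (Ioc 0 (2 * π) ×ˢ Ioc 0 (2 * π * R)))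

/-- The coordinate directions of `ℝ²`. -/
def coordDir : Fin 2 → ℝ × ℝ := ![(1, 0), (0, 1)]

/-- Smooth maps on `T_{1,R}`, by means of the covering `ℝ² → T_{1,R}`. -/
def SmoothOnTorus {V : Type} [NormedAddCommGroup V] [NormedSpace ℝ V] (R : ℝ)
    (f : Torus R → V) : Prop :=
  ContDiff ℝ ∞ (fun z => f (Torus.mk R z))

/-- The partial derivatives `∂_θ u`, `∂_φ u` of a map on the torus. -/
def pd (R : ℝ) (u : Torus R → E) (i : Fin 2) (x : Torus R) : E :=
  deriv (fun s : ℝ => u (x + Torus.mk R (s • coordDir i))) 0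

/-- Conformal smooth Legendrian embeddings `T_{1,R} → S⁵`. -/
structure IsConformalLegendrianEmbedding (R : ℝ) (u : Torus R → E) : Prop where
  smooth : SmoothOnTorus R u
  norm_eq : ∀ x, ‖u x‖ = 1
  isEmbedding : IsEmbedding u
  immersion : ∀ x, LinearIndependent ℝ ![pd R u 0 x, pd R u 1 x]
  conformal : ∀ x, ‖pd R u 0 x‖ = ‖pd R u 1 x‖ ∧ inner ℝ (pd R u 0 x) (pd R u 1 x) = 0
  legendrian : ∀ x i, contactForm (u x) (pd R u i x) = 0

/-- A smooth Legendrian immersion is Hamiltonian stationary if the first variation of its area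
vanishes along every Hamiltonian vector field. -/
def IsHamiltonianStationary (R : ℝ) (u : Torus R → E) : Prop :=
  ∀ F : E → ℝ, ContDiff ℝ ∞ F →
    ∫ x, divPlane (hamField F) (Submodule.span ℝ {pd R u 0 x, pd R u 1 x}) (u x)
      * areaElement (pd R u 0 x) (pd R u 1 x) ∂(Torus.area R) = 0

/-- `u ∈ W^{1,2}(T_{1,R}, ℂ³)` with weak partial derivatives `D 0`, `D 1`. -/
structure IsSobolevGradient (R : ℝ) (u : Torus R → E) (D : Fin 2 → Torus R → E) : Prop where
  memLp : MemLp u 2 (Torus.area R)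
  memLp_grad : ∀ i, MemLp (D i) 2 (Torus.area R)
  weak : ∀ (i : Fin 2) (ψ : ℝ × ℝ → ℝ), ContDiff ℝ ∞ ψ → HasCompactSupport ψ →
    ∫ z, fderiv ℝ ψ z (coordDir i) • u (Torus.mk R z) = -∫ z, ψ z • D i (Torus.mk R z)

/-- `(T_{1,R}, u, N)` is a parametrized Hamiltonian stationary Legendrian varifold (PHSLV) in
`S⁵`, where `u` is taken to be the continuous representative. The Hamiltonians allowed
for the domain `{f > t}` are those that vanish (on `S⁵`) near `u(f⁻¹(t))`. -/
structure IsPHSLV (R : ℝ) (u : Torus R → E) (N : Torus R → ℕ) : Prop where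
  continuous : Continuous u
  norm_eq : ∀ x, ‖u x‖ = 1
  measurable_mult : AEMeasurable N (Torus.area R)
  one_le_mult : ∀ᵐ x ∂(Torus.area R), 1 ≤ N x
  bounded_mult : ∃ C : ℕ, ∀ᵐ x ∂(Torus.area R), N x ≤ C
  stationary : ∃ D : Fin 2 → Torus R → E, IsSobolevGradient R u D ∧
    (∀ᵐ x ∂(Torus.area R), ∀ i, contactForm (u x) (D i x) = 0) ∧
    (∀ᵐ x ∂(Torus.area R), ‖D 0 x‖ = ‖D 1 x‖ ∧ inner ℝ (D 0 x) (D 1 x) = 0) ∧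
    ∀ f : Torus R → ℝ, SmoothOnTorus R f → (∀ x, 0 ≤ f x) →
      ∀ᵐ t ∂(volume.restrict (Ioi (0 : ℝ))),
        ∀ F : E → ℝ, ContDiff ℝ ∞ F →
          (∀ y, f y = t → ∀ᶠ q in 𝓝[Metric.sphere 0 1] (u y), F q = 0) →
          ∫ x in {x | t < f x}, (N x : ℝ) *
            ∑ i, inner ℝ (fderiv ℝ (hamField F) (u x) (D i x)) (D i x) ∂(Torus.area R) = 0

/-- `v` is the varifold induced by `(T_{1,R}, u, N)`, that is,
`v(B) = ∫ N |∇u|²/2` over the set of `x` with `(u(x), img ∇u(x)) ∈ B`. -/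
def IsInducedVarifold (R : ℝ) (u : Torus R → E) (N : Torus R → ℕ) (v : Measure LegGr) : Prop :=
  ∃ D : Fin 2 → Torus R → E, IsSobolevGradient R u D ∧
    ∀ B : Set LegGr, MeasurableSet B →
      v B = ∫⁻ x in {x | ∃ b ∈ B, b.pt = u x ∧ b.plane = Submodule.span ℝ {D 0 x, D 1 x}},
        (N x : ℝ≥0∞) * ENNReal.ofReal ((‖D 0 x‖ ^ 2 + ‖D 1 x‖ ^ 2) / 2) ∂(Torus.area R)

/-! ### The limit varifold -/

/-- The Hopf fiber `𝒞 = {(0, 0, e^{iα})}`. -/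
def hopfFiber : Set E := {p | p 0 = 0 ∧ p 1 = 0 ∧ ‖p 2‖ = 1}

/-- `(cos τ) e₁ + (sin τ) e₂`. -/
def vec1 (τ : ℝ) : E :=
  Real.cos τ • EuclideanSpace.single 0 1 + Real.sin τ • EuclideanSpace.single 0 Complex.I

/-- `(cos η) e₃ + (sin η) e₄`. -/
def vec2 (η : ℝ) : E :=
  Real.cos η • EuclideanSpace.single 1 1 + Real.sin η • EuclideanSpace.single 1 Complex.I

/-- The plane `𝒫_{τ,η} ⊂ T_{(0,0,1)} S⁵`. -/
def planeTorus (τ η : ℝ) : Submodule ℝ E := Submodule.span ℝ {vec1 τ, vec2 η}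

/-- The image of a plane under the (real linear) map `x ↦ c x`. -/
def rotPlane (c : ℂ) (P : Submodule ℝ E) : Submodule ℝ E :=
  P.map (DistribSMul.toLinearMap ℝ E c)

theorem isLegendrianPlane_rotPlane {p : E} (hp : p ∈ hopfFiber) (τ η : ℝ) :
    IsLegendrianPlane p (rotPlane (p 2) (planeTorus τ η)) := by
  obtain ⟨h0, h1, h2⟩ := hp
  have hne : p 2 ≠ 0 := by
    intro h
    simp [h] at h2
  have hinj : Function.Injective (DistribSMul.toLinearMap ℝ E (p 2)) := by
    intro x y hxy
    exact smul_right_injective E hne hxy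
  have hli : LinearIndependent ℝ ![vec1 τ, vec2 η] := by
    rw [LinearIndependent.pair_iff]
    intro s t hst
    have e0 := congrArg (fun x : E => x 0) hst
    have e1 := congrArg (fun x : E => x 1) hst
    simp [vec1, vec2, Complex.ext_iff] at e0 e1
    constructor
    · rcases e0 with ⟨a, b⟩
      by_contra hs
      have ha := a.resolve_left hs
      have hb := b.resolve_left hs
      rw [Complex.cos_ofReal_re] at ha
      rw [Complex.sin_ofReal_re] at hb
      have := Real.sin_sq_add_cos_sq τ
      rw [ha, hb] at this
      norm_num at this
    · rcases e1 with ⟨a, b⟩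
      by_contra hs
      have ha := a.resolve_left hs
      have hb := b.resolve_left hs
      rw [Complex.cos_ofReal_re] at ha
      rw [Complex.sin_ofReal_re] at hb
      have := Real.sin_sq_add_cos_sq η
      rw [ha, hb] at this
      norm_num at this
  have hmem : ∀ w ∈ rotPlane (p 2) (planeTorus τ η),
      ∃ s t : ℝ, p 2 • (s • vec1 τ + t • vec2 η) = w := by
    intro w hw
    obtain ⟨x, hx, rfl⟩ := Submodule.mem_map.1 hw
    obtain ⟨s, t, rfl⟩ := Submodule.mem_span_pair.1 hx
    exact ⟨s, t, rfl⟩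
  refine ⟨?_, ?_, ?_⟩
  · unfold rotPlane planeTorus
    rw [← (Submodule.equivMapOfInjective _ hinj _).finrank_eq]
    have h := finrank_span_eq_card hli
    rwa [Matrix.range_cons_cons_empty, Fintype.card_fin] at h
  · intro w hw
    obtain ⟨s, t, rfl⟩ := hmem w hw
    constructor <;>
    simp [contactForm, PiLp.inner_apply, Fin.sum_univ_three, h0, h1, vec1, vec2]
  · intro w hw w' hw'
    obtain ⟨s, t, rfl⟩ := hmem w hw
    obtain ⟨s', t', rfl⟩ := hmem w' hw'
    simp [PiLp.inner_apply, Fin.sum_univ_three, vec1, vec2]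
    ring

/-- The point `((e^{iα})_* 𝒫_{τ,η}, (0, 0, e^{iα}))` of the bundle of Legendrian planes, where
`p = (0, 0, e^{iα})`. -/
def fiberPlane (p : hopfFiber) (x : ℝ × ℝ) : LegGr where
  pt := p
  plane := rotPlane ((p : E) 2) (planeTorus x.1 x.2)
  norm_pt := by
    obtain ⟨p, h0, h1, h2⟩ := p
    simp [EuclideanSpace.norm_eq, Fin.sum_univ_three, h0, h1, h2]
  legendrian := isLegendrianPlane_rotPlane p.2 x.1 x.2

/-- The uniform probability measure on the torus of Legendrian planes
`{(e^{iα})_* 𝒫_{τ,η} : τ, η ∈ ℝ/2πℤ}` over `p = (0, 0, e^{iα})`. -/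
def uniformPlanes (p : hopfFiber) : Measure LegGr :=
  Measure.map (fiberPlane p)
    (ENNReal.ofReal ((2 * π) ^ 2)⁻¹ •
      (volume : Measure (ℝ × ℝ)).restrict (Ico 0 (2 * π) ×ˢ Ico 0 (2 * π)))

/-- The varifold `2π · μ(e^{iα}) ⊗ ℋ¹⌞𝒞`, that is,
`B ↦ 2π ∫_𝒞 μ(p)(B) dℋ¹(p)`. -/
def limitVarifold : Measure LegGr :=
  ENNReal.ofReal (2 * π) • Measure.bind (μH[1] : Measure hopfFiber) uniformPlanes

end

end HSL

namespace HSL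
noncomputable section

/-! ### Real linear algebra of `ℂ³` -/

/-! The tori are orbits of diagonal unitary maps: with `s = φ/R`, `u(θ, φ) = (sin β/√2 ·
e^{i(θ+ns)}, sin β/√2 · e^{i(-θ+ns)}, cos β · e^{-is})`. Such an orbit is Legendrian when `n sin²β =
cos²β`, and then conformal when `R sin²β = cos β`. By homogeneity all derivatives have constant
coefficients along the orbit, and one finds `i(Δu + |∇u|²u) = κ ∂_φ u` with `κ` constant
(`legTorus_laplacian`). The mean curvature turned by `i` is thus a divergence-free field on a flat
torus, so the first variation along `W_F` is the integral of exact derivatives. The localized form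
`setIntegral_legTorus_eq_zero` gives stationarity of the varifold, of the immersion and of the PHSLV
at once.

Now take `sin²β = 1/(n+1)` and `n → ∞`. The tori collapse onto the Hopf fiber, but their area `4π²
cos β` does not tend to zero. Near the limit the tangent plane is governed by the phases `θ + ns`
and `-θ + ns`, the base point by `-s`. Since `2ns` turns infinitely faster than `s`, the three
phases become independent and equidistributed (`tendsto_integral_phases`). The limit is therefore
the image of Haar measure on a product of three circles, and this is `limitVarifold` once length on
the fiber is identified with the arclength parameter (`hausdorffMeasure_hopfFiber`,
`limitVarifold_eq_map`). Stationarity survives because the plane divergence of a fixed `W_F` is a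
continuous test function.

The limit is carried by a curve. A `C¹` Legendrian surface piece meets that curve in a null set
(`IsRectifiableVarifold.measure_hopfFiber`), so the limit is not rectifiable; uniqueness of weak
limits extends this to every subsequence. -/

theorem inner_eq (x y : E) : inner ℝ x y =
    (x 0).re * (y 0).re + (x 0).im * (y 0).im + ((x 1).re * (y 1).re + (x 1).im * (y 1).im)
      + ((x 2).re * (y 2).re + (x 2).im * (y 2).im) := by
  simp [PiLp.inner_apply, Fin.sum_univ_three, Complex.inner]
  ring

theorem inner_I_smul_left (x y : E) :
    inner ℝ (Complex.I • x) y = -inner ℝ x (Complex.I • y) := by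
  simp only [inner_eq, PiLp.smul_apply, smul_eq_mul, Complex.mul_re, Complex.mul_im, Complex.I_re,
    Complex.I_im]
  ring

theorem inner_I_smul_I_smul (x y : E) :
    inner ℝ (Complex.I • x) (Complex.I • y) = inner ℝ x y := by
  simp only [inner_eq, PiLp.smul_apply, smul_eq_mul, Complex.mul_re, Complex.mul_im, Complex.I_re,
    Complex.I_im]
  ring

theorem inner_I_smul_self (x : E) : inner ℝ (Complex.I • x) x = 0 := by
  simp only [inner_eq, PiLp.smul_apply, smul_eq_mul, Complex.mul_re, Complex.mul_im, Complex.I_re,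
    Complex.I_im]
  ring

/-! ### Planes spanned by two vectors -/

theorem starProjection_span_pair {a b : E} (ha : ‖a‖ = 1) (hb : ‖b‖ = 1)
    (hab : inner ℝ a b = 0) :
    (Submodule.span ℝ {a, b}).starProjection =
      InnerProductSpace.rankOne ℝ a a + InnerProductSpace.rankOne ℝ b b := by
  ext1 x
  refine Submodule.eq_starProjection_of_mem_of_inner_eq_zero ?_ ?_ 
  · simp only [add_apply, InnerProductSpace.rankOne_apply]
    exact Submodule.mem_span_pair.2 ⟨_, _, rfl⟩
  · intro w hw
    obtain ⟨s, t, rfl⟩ := Submodule.mem_span_pair.1 hw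
    have hba : inner ℝ b a = 0 := by rw [real_inner_comm, hab]
    simp only [add_apply, InnerProductSpace.rankOne_apply,
      inner_sub_left, inner_add_left, inner_add_right, inner_smul_left, inner_smul_right,
      real_inner_self_eq_norm_sq, ha, hb, hab, hba, real_inner_comm x]
    simp

theorem trace_rankOne_comp (a : E) (A : E →L[ℝ] E) :
    LinearMap.trace ℝ E (InnerProductSpace.rankOne ℝ a a ∘L A : E →L[ℝ] E).toLinearMap =
      inner ℝ (A a) a := by
  rw [LinearMap.trace_eq_sum_inner _ (stdOrthonormalBasis ℝ E)]
  have h := (stdOrthonormalBasis ℝ E).sum_inner_mul_inner (ContinuousLinearMap.adjoint A a) a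
  rw [ContinuousLinearMap.adjoint_inner_left, real_inner_comm] at h
  rw [← h]
  refine Finset.sum_congr rfl fun i _ => ?_
  simp [inner_smul_right, ContinuousLinearMap.adjoint_inner_left]

theorem divPlane_span_pair (W : E → E) (p : E) {a b : E} (ha : ‖a‖ = 1) (hb : ‖b‖ = 1)
    (hab : inner ℝ a b = 0) :
    divPlane W (Submodule.span ℝ {a, b}) p =
      inner ℝ (fderiv ℝ W p a) a + inner ℝ (fderiv ℝ W p b) b := by
  unfold divPlane
  rw [starProjection_span_pair ha hb hab, ContinuousLinearMap.add_comp,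
    ContinuousLinearMap.toLinearMap_add, map_add, trace_rankOne_comp, trace_rankOne_comp]

/-- This makes the divergence an admissible test function for varifold convergence, which is how
stationarity passes to the limit. -/
theorem continuous_divPlane {W : E → E} (hW : Continuous (fderiv ℝ W)) :
    Continuous fun g : LegGr => divPlane W g.plane g.pt := by
  have h : Continuous fun g : LegGr => ((g.pt, g.plane.starProjection) : E × (E →L[ℝ] E)) :=
    continuous_induced_dom
  have hpt : Continuous fun g : LegGr => g.pt := continuous_fst.comp h
  have hpl : Continuous fun g : LegGr => g.plane.starProjection := continuous_snd.comp h
  have h2 : Continuous fun g : LegGr => g.plane.starProjection ∘L fderiv ℝ W g.pt :=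
    hpl.clm_comp (hW.comp hpt)
  let tr : (E →L[ℝ] E) →ₗ[ℝ] ℝ := LinearMap.trace ℝ E ∘ₗ ContinuousLinearMap.coeLM ℝ
  exact (tr.continuous_of_finiteDimensional).comp h2

/-! ### A family of Legendrian planes -/

/-- The point `(sin β z₁ / √2, sin β z₂ / √2, cos β z₃)` of `S⁵`. -/
def framePt (β : ℝ) (z : Circle × Circle × Circle) : E :=
  !₂[((sin β * (√2)⁻¹ : ℝ) : ℂ) * z.1, ((sin β * (√2)⁻¹ : ℝ) : ℂ) * z.2.1,
    ((cos β : ℝ) : ℂ) * z.2.2]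

/-- The first vector of a Legendrian frame at `framePt β z`. -/
def frame₁ (z : Circle × Circle × Circle) : E :=
  !₂[(((√2)⁻¹ : ℝ) : ℂ) * (Complex.I * z.1), -((((√2)⁻¹ : ℝ) : ℂ) * (Complex.I * z.2.1)), 0]

/-- The second vector of a Legendrian frame at `framePt β z`. -/
def frame₂ (β : ℝ) (z : Circle × Circle × Circle) : E :=
  !₂[((cos β * (√2)⁻¹ : ℝ) : ℂ) * (Complex.I * z.1),
    ((cos β * (√2)⁻¹ : ℝ) : ℂ) * (Complex.I * z.2.1),
    -(((sin β : ℝ) : ℂ) * (Complex.I * z.2.2))]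

theorem circle_re_sq_add_im_sq (z : Circle) : (z : ℂ).re ^ 2 + (z : ℂ).im ^ 2 = 1 := by
  have h := Circle.normSq_coe z
  rw [Complex.normSq_apply] at h
  linarith

theorem inv_sqrt_two_sq : (√2)⁻¹ ^ 2 = (1 / 2 : ℝ) := by
  rw [inv_pow, Real.sq_sqrt (by norm_num)]; norm_num

/-- Each relation is polynomial in the real and imaginary parts and follows from `|zⱼ| = 1` and
`sin² + cos² = 1`. No restriction on `β` is needed: the frame survives at `β = 0`, where the tori
collapse. -/
theorem frame_inner (β : ℝ) (z : Circle × Circle × Circle) :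
    inner ℝ (framePt β z) (framePt β z) = 1 ∧ inner ℝ (frame₁ z) (frame₁ z) = 1 ∧
    inner ℝ (frame₂ β z) (frame₂ β z) = 1 ∧ inner ℝ (frame₁ z) (frame₂ β z) = 0 ∧
    inner ℝ (framePt β z) (frame₁ z) = 0 ∧ inner ℝ (framePt β z) (frame₂ β z) = 0 ∧
    inner ℝ (Complex.I • framePt β z) (frame₁ z) = 0 ∧
    inner ℝ (Complex.I • framePt β z) (frame₂ β z) = 0 ∧
    inner ℝ (Complex.I • frame₁ z) (frame₂ β z) = 0 := by
  obtain ⟨z1, z2, z3⟩ := z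
  have h1 := circle_re_sq_add_im_sq z1
  have h2 := circle_re_sq_add_im_sq z2
  have h3 := circle_re_sq_add_im_sq z3
  have hs := Real.sin_sq_add_cos_sq β
  have hr := inv_sqrt_two_sq
  simp only [framePt, frame₁, frame₂, inner_eq, PiLp.smul_apply, smul_eq_mul,
    Matrix.cons_val_zero, Matrix.cons_val_one, Matrix.cons_val, Complex.re_ofReal_mul,
    Complex.im_ofReal_mul, Complex.I_mul_re, Complex.I_mul_im, Complex.neg_re, Complex.neg_im,
    Complex.zero_re, Complex.zero_im]
  generalize (z1 : ℂ).re = a1 at *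
  generalize (z1 : ℂ).im = b1 at *
  generalize (z2 : ℂ).re = a2 at *
  generalize (z2 : ℂ).im = b2 at *
  generalize (z3 : ℂ).re = a3 at *
  generalize (z3 : ℂ).im = b3 at *
  generalize sin β = s at *
  generalize cos β = c at *
  generalize (√2)⁻¹ = r at *
  refine ⟨?_, ?_, ?_, ?_, ?_, ?_, ?_, ?_, ?_⟩
  · linear_combination s^2 * r^2 * h1 + s^2*r^2*h2 + c^2 * h3 + hs + 2 * s^2 * hr
  · linear_combination r^2 * h1 + r^2*h2 + 2 * hr
  · linear_combination c^2 * r^2 * h1 + c^2*r^2*h2 + s^2 * h3 + hs + 2 * c^2 * hr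
  · linear_combination c * r^2 * h1 - c*r^2*h2
  · ring
  · ring
  · linear_combination s * r^2 * h1 - s*r^2*h2
  · linear_combination s * c * r^2 * h1 + s * c*r^2*h2 - s * c * h3 + 2 * s * c * hr
  · ring

theorem norm_framePt (β : ℝ) (z) : ‖framePt β z‖ = 1 := by
  have h := (frame_inner β z).1
  rw [real_inner_self_eq_norm_sq] at h
  exact (pow_eq_one_iff_of_nonneg (norm_nonneg _) two_ne_zero).1 h

theorem norm_frame₁ (z) : ‖frame₁ z‖ = 1 := by
  have h := (frame_inner 0 z).2.1
  rw [real_inner_self_eq_norm_sq] at h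
  exact (pow_eq_one_iff_of_nonneg (norm_nonneg _) two_ne_zero).1 h

theorem norm_frame₂ (β : ℝ) (z) : ‖frame₂ β z‖ = 1 := by
  have h := (frame_inner β z).2.2.1
  rw [real_inner_self_eq_norm_sq] at h
  exact (pow_eq_one_iff_of_nonneg (norm_nonneg _) two_ne_zero).1 h

theorem linearIndependent_of_orthogonal {a b : E} (ha : a ≠ 0) (hb : b ≠ 0)
    (hab : inner ℝ a b = 0) : LinearIndependent ℝ ![a, b] := by
  rw [LinearIndependent.pair_iff]
  intro s t h
  have hba : inner ℝ b a = 0 := by rw [real_inner_comm, hab]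
  constructor
  · have := congrArg (fun x => inner ℝ a x) h
    simpa [inner_add_right, inner_smul_right, hab, ha] using this
  · have := congrArg (fun x => inner ℝ b x) h
    simpa [inner_add_right, inner_smul_right, hba, hb] using this

theorem isLegendrianPlane_frame (β : ℝ) (z) :
    IsLegendrianPlane (framePt β z) (Submodule.span ℝ {frame₁ z, frame₂ β z}) := by
  obtain ⟨-, -, -, h12, h01, h02, hc1, hc2, hd⟩ := frame_inner β z
  have hd' : inner ℝ (Complex.I • frame₂ β z) (frame₁ z) = 0 := by
    rw [inner_I_smul_left, real_inner_comm, hd, neg_zero]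
  have hne1 : frame₁ z ≠ 0 := by
    intro h; have := norm_frame₁ z; simp [h] at this
  have hne2 : frame₂ β z ≠ 0 := by
    intro h; have := norm_frame₂ β z; simp [h] at this
  refine ⟨?_, ?_, ?_⟩
  · have h := finrank_span_eq_card (linearIndependent_of_orthogonal hne1 hne2 h12)
    rwa [Matrix.range_cons_cons_empty, Fintype.card_fin] at h
  · intro w hw
    obtain ⟨s, t, rfl⟩ := Submodule.mem_span_pair.1 hw
    simp [contactForm, inner_add_right, inner_smul_right, h01, h02, hc1, hc2]
  · intro w hw w' hw'
    obtain ⟨s, t, rfl⟩ := Submodule.mem_span_pair.1 hw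
    obtain ⟨s', t', rfl⟩ := Submodule.mem_span_pair.1 hw'
    rw [smul_add, smul_comm Complex.I s, smul_comm Complex.I t]
    simp [inner_add_right, inner_smul_right, inner_add_left, inner_smul_left, hd, hd',
      inner_I_smul_self]

/-- The Legendrian plane spanned by the frame at `framePt β z`. -/
def framePlane (x : ℝ × Circle × Circle × Circle) : LegGr where
  pt := framePt x.1 x.2
  plane := Submodule.span ℝ {frame₁ x.2, frame₂ x.1 x.2}
  norm_pt := norm_framePt _ _
  legendrian := isLegendrianPlane_frame _ _

theorem continuous_rankOne_self :
    Continuous fun a : E => InnerProductSpace.rankOne ℝ a a := by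
  have h : (fun a : E => InnerProductSpace.rankOne ℝ a a) =
      fun a => ContinuousLinearMap.smulRightL ℝ E E (innerSL ℝ a) a := by
    funext a
    ext1 x
    simp
  rw [h]
  exact (((ContinuousLinearMap.smulRightL ℝ E E).continuous.comp
    (innerSL ℝ).continuous).clm_apply continuous_id)

/-- The projection onto the plane is a sum of two rank-one maps built from the orthonormal frame,
hence continuous up to and including `β = 0`. -/
theorem continuous_framePlane : Continuous framePlane := by
  have h0 : Continuous fun x : ℝ × Circle × Circle × Circle => framePt x.1 x.2 := by
    refine (PiLp.continuous_toLp 2 _).comp (continuous_pi fun i => ?_)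
    fin_cases i <;> simp <;> fun_prop
  have h1 : Continuous fun x : ℝ × Circle × Circle × Circle => frame₁ x.2 := by
    refine (PiLp.continuous_toLp 2 _).comp (continuous_pi fun i => ?_)
    fin_cases i <;> simp <;> fun_prop
  have h2 : Continuous fun x : ℝ × Circle × Circle × Circle => frame₂ x.1 x.2 := by
    refine (PiLp.continuous_toLp 2 _).comp (continuous_pi fun i => ?_)
    fin_cases i <;> simp <;> fun_prop
  refine continuous_induced_rng.2 (h0.prodMk ?_)
  have : (fun x => (framePlane x).plane.starProjection) = fun x =>
      InnerProductSpace.rankOne ℝ (frame₁ x.2) (frame₁ x.2) +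
        InnerProductSpace.rankOne ℝ (frame₂ x.1 x.2) (frame₂ x.1 x.2) := by
    funext x
    exact starProjection_span_pair (norm_frame₁ _) (norm_frame₂ _ _) (frame_inner _ _).2.2.2.1
  rw [this]
  exact (continuous_rankOne_self.comp h1).add (continuous_rankOne_self.comp h2)

/-! ### Hamiltonian vector fields -/

theorem inner_gradient (F : E → ℝ) (p w : E) : inner ℝ (gradient F p) w = fderiv ℝ F p w := by
  rw [gradient, InnerProductSpace.toDual_symm_apply]

theorem contDiff_gradient {F : E → ℝ} (hF : ContDiff ℝ ∞ F) : ContDiff ℝ ∞ (gradient F) :=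
  (InnerProductSpace.toDual ℝ E).symm.contDiff.comp (hF.fderiv_right le_rfl)

theorem contDiff_I_smul {f : E → E} (hf : ContDiff ℝ ∞ f) :
    ContDiff ℝ ∞ fun p => Complex.I • f p :=
  hf.const_smul Complex.I

theorem contDiff_hamField {F : E → ℝ} (hF : ContDiff ℝ ∞ F) : ContDiff ℝ ∞ (hamField F) := by
  have hg := contDiff_gradient hF
  have hI := contDiff_I_smul (contDiff_id (𝕜 := ℝ) (E := E))
  have hh : ContDiff ℝ ∞ (horGrad F) :=
    (hg.sub ((contDiff_id.inner ℝ hg).smul contDiff_id)).sub ((hI.inner ℝ hg).smul hI)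
  exact ((contDiff_I_smul hh).const_smul (1 / 2 : ℝ)).add (hF.smul hI)

theorem continuous_fderiv_hamField {F : E → ℝ} (hF : ContDiff ℝ ∞ F) :
    Continuous (fderiv ℝ (hamField F)) :=
  (contDiff_hamField hF).continuous_fderiv (by simp)

/-- Moving `J` onto `w` turns the pairing into a derivative of `F`. It is used with `w = Δu` and `m
= |∇u|²`, where the direction of differentiation is `i` times the mean curvature term. -/
theorem inner_hamField {F : E → ℝ} {p w : E} {m : ℝ} (hpw : inner ℝ p w = -m)
    (hIpw : inner ℝ (Complex.I • p) w = 0) :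
    inner ℝ (hamField F p) w =
      -(1 / 2) * fderiv ℝ F p (Complex.I • w + m • (Complex.I • p)) := by
  have h1 : inner ℝ p (Complex.I • w) = 0 := by
    rw [← neg_eq_zero, ← inner_I_smul_left, hIpw]
  have h2 : inner ℝ (Complex.I • p) (Complex.I • w) = -m := by rw [inner_I_smul_I_smul, hpw]
  rw [map_add, ← inner_gradient, ← inner_gradient]
  simp only [hamField, horGrad, inner_add_left, inner_smul_left, hIpw, inner_I_smul_left (_ - _),
    inner_sub_left, h1, h2, inner_smul_right, real_inner_comm (gradient F p)]
  simp
  ring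

/-- The normalized line `q + t h` stays on the sphere and, as `h` is tangent, has velocity `h` at `t
= 0`. -/
theorem fderiv_eq_zero_of_eventually_sphere {F : E → ℝ} {q h : E} (hF : DifferentiableAt ℝ F q)
    (hq : ‖q‖ = 1) (hqh : inner ℝ q h = 0)
    (h0 : ∀ᶠ p in 𝓝[Metric.sphere 0 1] q, F p = 0) : fderiv ℝ F q h = 0 := by
  have hpos : ∀ t : ℝ, 0 < 1 + t ^ 2 * ‖h‖ ^ 2 := fun t => by positivity
  let γ : ℝ → E := fun t => (√(1 + t ^ 2 * ‖h‖ ^ 2))⁻¹ • (q + t • h)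
  have hγ0 : γ 0 = q := by simp [γ]
  have hnorm : ∀ t, ‖γ t‖ = 1 := by
    intro t
    have e : ‖q + t • h‖ = √(1 + t ^ 2 * ‖h‖ ^ 2) := by
      rw [eq_comm, Real.sqrt_eq_iff_mul_self_eq (hpos t).le (norm_nonneg _), ← pow_two,
        norm_add_sq_real, hq, inner_smul_right, hqh, norm_smul, mul_pow]
      simp
    simp only [γ]
    rw [norm_smul, e, norm_inv, Real.norm_of_nonneg (Real.sqrt_nonneg _),
      inv_mul_cancel₀ (Real.sqrt_pos.2 (hpos t)).ne']
  have hd : HasDerivAt γ h 0 := by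
    have e1 : HasDerivAt (fun t : ℝ => 1 + t ^ 2 * ‖h‖ ^ 2) 0 0 := by
      simpa using (((hasDerivAt_id (0 : ℝ)).pow 2).mul_const (‖h‖ ^ 2)).const_add 1
    have e2 := (e1.sqrt (by simp)).inv (by simp)
    have e3 : HasDerivAt (fun t : ℝ => q + t • h) h 0 := by
      simpa using ((hasDerivAt_id (0 : ℝ)).smul_const h).const_add q
    exact (e2.smul e3).congr_deriv (by simp)
  have ht : Tendsto γ (𝓝 0) (𝓝[Metric.sphere 0 1] q) := by
    refine tendsto_nhdsWithin_iff.2 ⟨?_, Eventually.of_forall fun t => by simp [hnorm t]⟩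
    simpa [hγ0] using hd.continuousAt.tendsto
  have hcomp : HasDerivAt (F ∘ γ) (fderiv ℝ F q h) 0 := by
    have hF' : HasFDerivAt F (fderiv ℝ F q) (γ 0) := by rw [hγ0]; exact hF.hasFDerivAt
    exact hF'.comp_hasDerivAt 0 hd
  have hz : F ∘ γ =ᶠ[𝓝 0] fun _ => 0 := ht.eventually h0
  exact hcomp.unique ((hasDerivAt_const (0 : ℝ) (0 : ℝ)).congr_of_eventuallyEq hz)

/-- The horizontal gradient is tangent to the sphere, so its squared norm is the derivative of `F`
along itself, which only sees `F` on the sphere. -/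
theorem hamField_eq_zero_of_eventually_sphere {F : E → ℝ} {q : E} (hF : DifferentiableAt ℝ F q)
    (hq : ‖q‖ = 1) (h0 : ∀ᶠ p in 𝓝[Metric.sphere 0 1] q, F p = 0) : hamField F q = 0 := by
  have hFq : F q = 0 := h0.self_of_nhdsWithin (by simpa using hq)
  have hqI : inner ℝ q (Complex.I • q) = 0 := by rw [real_inner_comm, inner_I_smul_self]
  have hqq : inner ℝ q q = 1 := by rw [real_inner_self_eq_norm_sq, hq, one_pow]
  have h1 : inner ℝ q (horGrad F q) = 0 := by
    simp [horGrad, inner_sub_right, inner_smul_right, hqI, hq]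
  have h2 : inner ℝ (Complex.I • q) (horGrad F q) = 0 := by
    simp only [horGrad, inner_sub_right, inner_smul_right, inner_I_smul_self, inner_I_smul_I_smul,
      hqq]
    ring
  have h3 : inner ℝ (gradient F q) (horGrad F q) = 0 := by
    rw [inner_gradient]
    exact fderiv_eq_zero_of_eventually_sphere hF hq h1 h0
  have h4 : horGrad F q = 0 := by
    rw [← inner_self_eq_zero (𝕜 := ℝ)]
    nth_rewrite 1 [horGrad]
    simp [inner_sub_left, inner_smul_left, h1, h2, h3]
  simp [hamField, h4, hFq]

/-! ### Toral maps -/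

theorem hasDerivAt_vec3 {f g h : ℝ → ℂ} {f' g' h' : ℂ} {s : ℝ} (hf : HasDerivAt f f' s)
    (hg : HasDerivAt g g' s) (hh : HasDerivAt h h' s) :
    HasDerivAt (fun t => (!₂[f t, g t, h t] : E)) !₂[f', g', h'] s := by
  have hp : HasDerivAt (fun t => (![f t, g t, h t] : Fin 3 → ℂ)) ![f', g', h'] s := by
    rw [hasDerivAt_pi]
    intro i
    fin_cases i
    exacts [hf, hg, hh]
  exact ((PiLp.continuousLinearEquiv 2 ℝ fun _ : Fin 3 => ℂ).symm.hasFDerivAt).comp_hasDerivAt s hp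

theorem contDiff_vec3 {V : Type*} [NormedAddCommGroup V] [NormedSpace ℝ V] {f g h : V → ℂ}
    (hf : ContDiff ℝ ∞ f) (hg : ContDiff ℝ ∞ g) (hh : ContDiff ℝ ∞ h) :
    ContDiff ℝ ∞ (fun t => (!₂[f t, g t, h t] : E)) := by
  have hp : ContDiff ℝ ∞ (fun t => (![f t, g t, h t] : Fin 3 → ℂ)) := by
    rw [contDiff_pi]
    intro i
    fin_cases i
    exacts [hf, hg, hh]
  exact ((PiLp.continuousLinearEquiv 2 ℝ fun _ : Fin 3 => ℂ).symm.contDiff).comp hp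

theorem hasDerivAt_toCircle {T : ℝ} (x : AddCircle T) :
    HasDerivAt (fun s : ℝ => ((x + (s : AddCircle T)).toCircle : ℂ))
      (((2 * π / T : ℝ) : ℂ) * (Complex.I * x.toCircle)) 0 := by
  have h1 : HasDerivAt (fun s : ℝ => Complex.exp (((2 * π / T * s : ℝ) : ℂ) * Complex.I))
      (((2 * π / T : ℝ) : ℂ) * Complex.I) 0 := by
    have e : HasDerivAt (fun s : ℝ => 2 * π / T * s) (2 * π / T) 0 := by
      simpa using (hasDerivAt_id (0 : ℝ)).const_mul (2 * π / T)
    simpa using (e.ofReal_comp.mul_const Complex.I).cexp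
  have h2 := h1.const_mul (x.toCircle : ℂ)
  refine (h2.congr_deriv (by ring)).congr_of_eventuallyEq (Eventually.of_forall fun s => ?_)
  simp only [AddCircle.toCircle_add, AddCircle.toCircle_apply_mk, Circle.coe_mul, Circle.coe_exp]

/-- The orbit of `(a, b, c)` under the two-parameter group of the diagonal unitary maps
`diag(z wⁿ, z⁻¹ wⁿ, w⁻¹)`. -/
def toral (n : ℕ) (a b c : ℂ) {R : ℝ} (x : Torus R) : E :=
  !₂[a * (x.1.toCircle * x.2.toCircle ^ n), b * (x.1.toCircle⁻¹ * x.2.toCircle ^ n),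
    c * (x.2.toCircle : ℂ)⁻¹]

/-- Differentiating an orbit multiplies each amplitude by `i` times its frequency and yields another
`toral` map; all calculus on the tori reduces to algebra of amplitudes. -/
theorem hasDerivAt_toral_zero (n : ℕ) (a b c : ℂ) {R : ℝ} (x : Torus R) :
    HasDerivAt (fun s : ℝ => toral n a b c (x + Torus.mk R (s • coordDir 0)))
      (toral n (a * Complex.I) (-(b * Complex.I)) 0 x) 0 := by
  have h1 := hasDerivAt_toCircle x.1
  have hz : (x.1.toCircle : ℂ) ≠ 0 := Circle.coe_ne_zero _
  rw [div_self (by positivity)] at h1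
  have h1i := h1.inv (by simp)
  have hf := (h1.mul_const ((x.2.toCircle : ℂ) ^ n)).const_mul a
  have hg := (h1i.mul_const ((x.2.toCircle : ℂ) ^ n)).const_mul b
  have := hasDerivAt_vec3 hf hg (hasDerivAt_const (0 : ℝ) (c * (x.2.toCircle : ℂ)⁻¹))
  refine (this.congr_deriv ?_).congr_of_eventuallyEq (Eventually.of_forall fun s => ?_)
  · ext i
    fin_cases i
    · simp [toral]; ring
    · simp [toral]; field_simp
    · simp [toral]
  · simp [toral, Torus.mk, coordDir]

theorem hasDerivAt_toral_one (n : ℕ) (a b c : ℂ) {R : ℝ} (hR : R ≠ 0) (x : Torus R) :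
    HasDerivAt (fun s : ℝ => toral n a b c (x + Torus.mk R (s • coordDir 1)))
      (toral n (a * (n * Complex.I / R)) (b * (n * Complex.I / R)) (c * (-Complex.I / R)) x) 0 := by
  have h1 := hasDerivAt_toCircle x.2
  have hz : (x.2.toCircle : ℂ) ≠ 0 := Circle.coe_ne_zero _
  rw [show 2 * π / (2 * π * R) = 1 / R by field_simp] at h1
  have hRc : (R : ℂ) ≠ 0 := by exact_mod_cast hR
  have h1i := h1.inv (by simp)
  have hp := h1.pow n
  have hf := (hp.const_mul (x.1.toCircle : ℂ)).const_mul a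
  have hg := (hp.const_mul (x.1.toCircle : ℂ)⁻¹).const_mul b
  have := hasDerivAt_vec3 hf hg (h1i.const_mul c)
  refine (this.congr_deriv ?_).congr_of_eventuallyEq (Eventually.of_forall fun s => ?_)
  -- The exponent `n - 1` is truncated at `n = 0`; there the factor `n` vanishes.
  · have key : (n : ℂ) * (x.2.toCircle : ℂ) ^ (n - 1) * (x.2.toCircle : ℂ) =
        n * (x.2.toCircle : ℂ) ^ n := by
      rcases Nat.eq_zero_or_pos n with rfl | hn
      · simp
      · rw [mul_assoc, pow_sub_one_mul hn.ne']
    ext i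
    fin_cases i
    · simp [toral]; linear_combination a * x.1.toCircle * (Complex.I / R) * key
    · simp [toral]; linear_combination b * (x.1.toCircle : ℂ)⁻¹ * (Complex.I / R) * key
    · simp [toral]; field_simp
  · simp [toral, Torus.mk, coordDir]

theorem smoothOnTorus_toral (n : ℕ) (a b c : ℂ) (R : ℝ) :
    SmoothOnTorus R (toral n a b c : Torus R → E) := by
  have he : ∀ T : ℝ, ContDiff ℝ ∞ fun s : ℝ => (AddCircle.toCircle (s : AddCircle T) : ℂ) := by
    intro T
    simp only [AddCircle.toCircle_apply_mk, Circle.coe_exp]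
    have : ContDiff ℝ ∞ fun s : ℝ => ((2 * π / T * s : ℝ) : ℂ) :=
      Complex.ofRealCLM.contDiff.comp (contDiff_const.mul contDiff_id)
    exact (this.mul contDiff_const).cexp
  have h1 : ContDiff ℝ ∞ fun z : ℝ × ℝ => (AddCircle.toCircle (z.1 : AddCircle (2 * π)) : ℂ) :=
    (he _).comp contDiff_fst
  have h2 : ContDiff ℝ ∞ fun z : ℝ × ℝ => (AddCircle.toCircle (z.2 : AddCircle (2 * π * R)) : ℂ) :=
    (he _).comp contDiff_snd
  exact contDiff_vec3 (contDiff_const.mul (h1.mul (h2.pow n)))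
    (contDiff_const.mul ((h1.inv fun _ => Circle.coe_ne_zero _).mul (h2.pow n)))
    (contDiff_const.mul (h2.inv fun _ => Circle.coe_ne_zero _))

theorem continuous_toral (n : ℕ) (a b c : ℂ) {R : ℝ} :
    Continuous (toral n a b c : Torus R → E) := by
  have h1 : Continuous fun x : Torus R => (x.1.toCircle : ℂ) :=
    continuous_subtype_val.comp (AddCircle.continuous_toCircle.comp continuous_fst)
  have h2 : Continuous fun x : Torus R => (x.2.toCircle : ℂ) :=
    continuous_subtype_val.comp (AddCircle.continuous_toCircle.comp continuous_snd)
  refine (PiLp.continuous_toLp 2 _).comp (continuous_pi fun i => ?_)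
  fin_cases i
  · exact continuous_const.mul (h1.mul (h2.pow n))
  · exact continuous_const.mul ((h1.inv₀ fun _ => Circle.coe_ne_zero _).mul (h2.pow n))
  · exact continuous_const.mul (h2.inv₀ fun _ => Circle.coe_ne_zero _)

/-! ### Integration on the torus -/

instance fact_two_pi_pos : Fact (0 < 2 * π) := ⟨Real.two_pi_pos⟩

theorem fact_pos_mul {R : ℝ} (hR : 0 < R) : Fact (0 < 2 * π * R) := ⟨by positivity⟩

theorem torus_area_eq_volume (R : ℝ) [Fact (0 < 2 * π * R)] :
    Torus.area R = (volume : Measure (Torus R)) := by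
  have h1 := AddCircle.measurePreserving_mk (2 * π) 0
  have h2 := AddCircle.measurePreserving_mk (2 * π * R) 0
  rw [zero_add] at h1 h2
  have h := (h1.prod h2).map_eq
  rw [Measure.prod_restrict] at h
  exact h

instance isAddLeftInvariant_volume_prod {T T' : ℝ} [Fact (0 < T)] [Fact (0 < T')] :
    (volume : Measure (AddCircle T × AddCircle T')).IsAddLeftInvariant :=
  inferInstanceAs ((volume : Measure (AddCircle T)).prod
    (volume : Measure (AddCircle T'))).IsAddLeftInvariant

theorem continuous_torus_mk (R : ℝ) : Continuous (Torus.mk R) :=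
  ((AddCircle.continuous_mk' _).comp continuous_fst).prodMk
    ((AddCircle.continuous_mk' _).comp continuous_snd)

theorem torus_mk_add (R : ℝ) (z z' : ℝ × ℝ) : Torus.mk R (z + z') = Torus.mk R z + Torus.mk R z' :=
  rfl

theorem hasDerivAt_torus_translate {V : Type*} [NormedAddCommGroup V] [NormedSpace ℝ V] {R : ℝ}
    {i : Fin 2} {g g' : Torus R → V}
    (h : ∀ x, HasDerivAt (fun s : ℝ => g (x + Torus.mk R (s • coordDir i))) (g' x) 0)
    (x : Torus R) (t : ℝ) :
    HasDerivAt (fun s : ℝ => g (x + Torus.mk R (s • coordDir i)))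
      (g' (x + Torus.mk R (t • coordDir i))) t := by
  have h1 := h (x + Torus.mk R (t • coordDir i))
  rw [← sub_self t] at h1
  have h2 := h1.comp_sub_const t t
  refine h2.congr_of_eventuallyEq (Eventually.of_forall fun s => ?_)
  simp only
  rw [add_assoc, ← torus_mk_add, ← add_smul, add_sub_cancel]

/-- The integral of a translate of `g` does not depend on the translation; differentiate it under
the integral sign. Only measurability and bounds are asked, so that `g` may be cut off by an
indicator. -/
theorem integral_torus_hasDerivAt {R : ℝ} (hR : 0 < R) (i : Fin 2) {g g' : Torus R → ℝ} {C : ℝ}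
    (hg : Measurable g) (hgC : ∀ x, |g x| ≤ C) (hg' : Measurable g') (hgC' : ∀ x, |g' x| ≤ C)
    (h : ∀ x, HasDerivAt (fun s : ℝ => g (x + Torus.mk R (s • coordDir i))) (g' x) 0) :
    ∫ x, g' x ∂(Torus.area R) = 0 := by
  have := fact_pos_mul hR
  rw [torus_area_eq_volume]
  have key := (hasDerivAt_integral_of_dominated_loc_of_deriv_le (μ := (volume : Measure (Torus R)))
    (F := fun (s : ℝ) x => g (x + Torus.mk R (s • coordDir i)))
    (F' := fun (s : ℝ) x => g' (x + Torus.mk R (s • coordDir i))) (x₀ := (0 : ℝ))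
    (bound := fun _ => C) (s := univ) univ_mem
    (Eventually.of_forall fun s => (hg.comp (measurable_add_const _)).aestronglyMeasurable)
    (Integrable.of_bound (hg.comp (measurable_add_const _)).aestronglyMeasurable C
      (Eventually.of_forall fun x => hgC _))
    (hg'.comp (measurable_add_const _)).aestronglyMeasurable
    (Eventually.of_forall fun x s _ => hgC' _) (integrable_const _)
    (Eventually.of_forall fun x s _ => hasDerivAt_torus_translate h x s)).2
  have e : (fun s : ℝ => ∫ x, g (x + Torus.mk R (s • coordDir i))) = fun _ => ∫ x, g x := by
    funext s
    exact integral_add_right_eq_self g _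
  rw [e] at key
  have e2 := key.unique (hasDerivAt_const (0 : ℝ) (∫ x, g x))
  rwa [integral_add_right_eq_self g'] at e2

/-- Since `g` vanishes near the frontier, cutting it off outside `U` creates no jump and the
previous lemma applies to the indicator. -/
theorem setIntegral_torus_hasDerivAt {R : ℝ} (hR : 0 < R) (i : Fin 2) {g g' : Torus R → ℝ}
    {U : Set (Torus R)} (hU : IsOpen U) (hg : Continuous g) (hg' : Continuous g')
    (h : ∀ x, HasDerivAt (fun s : ℝ => g (x + Torus.mk R (s • coordDir i))) (g' x) 0)
    (h0 : ∀ y ∈ frontier U, ∀ᶠ x in 𝓝 y, g x = 0) :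
    ∫ x in U, g' x ∂(Torus.area R) = 0 := by
  have := fact_pos_mul hR
  obtain ⟨C, hC⟩ := isCompact_univ.exists_bound_of_continuousOn hg.continuousOn
  obtain ⟨C', hC'⟩ := isCompact_univ.exists_bound_of_continuousOn hg'.continuousOn
  rw [← integral_indicator hU.measurableSet]
  have hb : ∀ (k : Torus R → ℝ) (D : ℝ), (∀ x ∈ univ, ‖k x‖ ≤ D) → D ≤ max C C' →
      ∀ x, |U.indicator k x| ≤ max C C' := fun k D hk hD x =>
    (norm_indicator_le_norm_self k x).trans ((hk x trivial).trans hD)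
  refine integral_torus_hasDerivAt hR i (hg.measurable.indicator hU.measurableSet)
    (hb g C hC (le_max_left _ _)) (hg'.measurable.indicator hU.measurableSet)
    (hb g' C' hC' (le_max_right _ _)) fun x => ?_
  have hcont : Tendsto (fun s : ℝ => x + Torus.mk R (s • coordDir i)) (𝓝 0) (𝓝 x) := by
    have : Continuous fun s : ℝ => x + Torus.mk R (s • coordDir i) :=
      continuous_const.add ((continuous_torus_mk R).comp (continuous_id.smul continuous_const))
    have h2 := this.tendsto 0
    have e0 : Torus.mk R 0 = 0 := rfl
    simpa [e0] using h2
  by_cases hx : x ∈ U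
  · rw [indicator_of_mem hx]
    refine (h x).congr_of_eventuallyEq ?_
    filter_upwards [hcont.eventually (hU.mem_nhds hx)] with s hs
    exact indicator_of_mem hs g
  · rw [indicator_of_notMem hx]
    refine (hasDerivAt_const (0 : ℝ) (0 : ℝ)).congr_of_eventuallyEq ?_
    have : ∀ᶠ y in 𝓝 x, U.indicator g y = 0 := by
      by_cases hc : x ∈ closure U
      · filter_upwards [h0 x ⟨hc, by rwa [hU.interior_eq]⟩] with y hy
        simp [indicator, hy]
      · filter_upwards [isClosed_closure.isOpen_compl.mem_nhds hc] with y hy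
        exact indicator_of_notMem (fun hyU => hy (subset_closure hyU)) g
    exact hcont.eventually this

/-! ### Homogeneous Legendrian tori -/

/-- The three phases `z wⁿ`, `z⁻¹ wⁿ`, `w⁻¹`. -/
def phases (n : ℕ) {R : ℝ} (x : Torus R) : Circle × Circle × Circle :=
  (x.1.toCircle * x.2.toCircle ^ n, x.1.toCircle⁻¹ * x.2.toCircle ^ n, x.2.toCircle⁻¹)

theorem continuous_phases (n : ℕ) {R : ℝ} : Continuous (phases n : Torus R → _) := by
  have h1 : Continuous fun x : Torus R => x.1.toCircle :=
    AddCircle.continuous_toCircle.comp continuous_fst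
  have h2 : Continuous fun x : Torus R => x.2.toCircle :=
    AddCircle.continuous_toCircle.comp continuous_snd
  exact (h1.mul (h2.pow n)).prodMk ((h1.inv.mul (h2.pow n)).prodMk h2.inv)

/-- A homogeneous torus in `S⁵`. -/
def legTorus (n : ℕ) (β : ℝ) {R : ℝ} (x : Torus R) : E := framePt β (phases n x)

/-- The orthonormal frame `frame₁`, `frame₂` along the torus, scaled by `sin β`. -/
def legTorusGrad (n : ℕ) (β : ℝ) {R : ℝ} (i : Fin 2) (x : Torus R) : E :=
  sin β • ![frame₁ (phases n x), frame₂ β (phases n x)] i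

theorem legTorus_eq (n : ℕ) (β : ℝ) {R : ℝ} : (legTorus n β : Torus R → E) =
    toral n ((sin β * (√2)⁻¹ : ℝ) : ℂ) ((sin β * (√2)⁻¹ : ℝ) : ℂ) ((cos β : ℝ) : ℂ) := by
  funext x
  simp [legTorus, framePt, phases, toral]

theorem legTorusGrad_zero (n : ℕ) (β : ℝ) {R : ℝ} : (legTorusGrad n β 0 : Torus R → E) =
    toral n (((sin β * (√2)⁻¹ : ℝ) : ℂ) * Complex.I) (-(((sin β * (√2)⁻¹ : ℝ) : ℂ) * Complex.I))
      0 := by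
  funext x
  ext i
  fin_cases i <;> simp [legTorusGrad, frame₁, phases, toral] <;> ring

theorem legTorusGrad_one (n : ℕ) (β : ℝ) {R : ℝ} : (legTorusGrad n β 1 : Torus R → E) =
    toral n (((sin β * cos β * (√2)⁻¹ : ℝ) : ℂ) * Complex.I)
      (((sin β * cos β * (√2)⁻¹ : ℝ) : ℂ) * Complex.I) (-(((sin β ^ 2 : ℝ) : ℂ) * Complex.I)) := by
  funext x
  ext i
  fin_cases i <;> simp [legTorusGrad, frame₂, phases, toral] <;> ring

/-- The relations between the parameters of a homogeneous torus that make it conformal. -/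
structure IsConformalParam (n : ℕ) (β R : ℝ) : Prop where
  sin_pos : 0 < sin β
  cos_pos : 0 < cos β
  pos : 0 < R
  -- This is the Legendrian condition: the contact form on `∂_φ u` equals `(n sin²β - cos²β)/R`.
  freq : n * sin β ^ 2 = cos β ^ 2
  -- Given `freq`, this says `|∂_φ u| = |∂_θ u| = sin β`.
  length : R * sin β ^ 2 = cos β

variable {n : ℕ} {β R : ℝ}

theorem IsConformalParam.div_eq (h : IsConformalParam n β R) : (n : ℂ) / R = (cos β : ℝ) := by
  have h1 := h.sin_pos
  have h2 := h.pos
  rw [← Complex.ofReal_natCast, ← Complex.ofReal_div]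
  congr 1
  rw [div_eq_iff h2.ne']
  have : sin β ^ 2 * (n - cos β * R) = 0 := by linear_combination h.freq - cos β * h.length
  rcases mul_eq_zero.1 this with h0 | h0
  · exact absurd h0 (by positivity)
  · linarith

theorem IsConformalParam.inv_eq (h : IsConformalParam n β R) :
    (R : ℂ)⁻¹ = ((sin β ^ 2 / cos β : ℝ) : ℂ) := by
  have h1 := h.cos_pos
  have h2 := h.pos
  rw [← Complex.ofReal_inv]
  congr 1
  field_simp
  linarith [h.length]

theorem hasDerivAt_legTorus (h : IsConformalParam n β R) (i : Fin 2) (x : Torus R) :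
    HasDerivAt (fun s : ℝ => legTorus n β (x + Torus.mk R (s • coordDir i)))
      (legTorusGrad n β i x) 0 := by
  rw [legTorus_eq]
  fin_cases i
  · refine (hasDerivAt_toral_zero n _ _ _ x).congr_deriv ?_
    simp only [Fin.zero_eta, legTorusGrad_zero]
  · refine (hasDerivAt_toral_one n _ _ _ h.pos.ne' x).congr_deriv ?_
    have h1 : (n : ℂ) * Complex.I / R = (cos β : ℝ) * Complex.I := by
      rw [← h.div_eq]; ring
    have hc : ((cos β : ℝ) : ℂ) ≠ 0 := by exact_mod_cast h.cos_pos.ne'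
    have h2 : ((cos β : ℝ) : ℂ) * (-Complex.I / R) = -(((sin β ^ 2 : ℝ) : ℂ) * Complex.I) := by
      rw [div_eq_mul_inv, h.inv_eq]
      push_cast at hc ⊢
      field_simp
    simp only [Fin.mk_one, legTorusGrad_one, h1, h2]
    congr 1 <;> push_cast <;> ring

theorem pd_legTorus (h : IsConformalParam n β R) (i : Fin 2) (x : Torus R) :
    pd R (legTorus n β) i x = legTorusGrad n β i x :=
  (hasDerivAt_legTorus h i x).deriv

theorem inner_toral (n : ℕ) (a b c a' b' c' : ℂ) {R : ℝ} (x : Torus R) :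
    inner ℝ (toral n a b c x) (toral n a' b' c' x) =
      a.re * a'.re + a.im * a'.im + (b.re * b'.re + b.im * b'.im)
        + (c.re * c'.re + c.im * c'.im) := by
  have key : ∀ (v v' : ℂ) (ζ : Circle), (v * ζ).re * (v' * ζ).re + (v * ζ).im * (v' * ζ).im =
      v.re * v'.re + v.im * v'.im := by
    intro v v' ζ
    simp only [Complex.mul_re, Complex.mul_im]
    linear_combination (v.re * v'.re + v.im * v'.im) * circle_re_sq_add_im_sq ζ
  have h1 := key a a' (x.1.toCircle * x.2.toCircle ^ n)
  have h2 := key b b' (x.1.toCircle⁻¹ * x.2.toCircle ^ n)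
  have h3 := key c c' (x.2.toCircle⁻¹)
  push_cast at h1 h2 h3
  rw [← h1, ← h2, ← h3, inner_eq]
  simp [toral]

/-- The Laplacian of the homogeneous torus. -/
theorem legTorus_laplacian (h : IsConformalParam n β R) : ∃ (S : Fin 2 → Torus R → E) (κ : ℝ),
    (∀ i, Continuous (S i)) ∧
    (∀ i x, HasDerivAt (fun s : ℝ => legTorusGrad n β i (x + Torus.mk R (s • coordDir i)))
      (S i x) 0) ∧
    ∀ x, inner ℝ (legTorus n β x) (S 0 x + S 1 x) = -(2 * sin β ^ 2) ∧
      inner ℝ (Complex.I • legTorus n β x) (S 0 x + S 1 x) = 0 ∧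
      Complex.I • (S 0 x + S 1 x) + (2 * sin β ^ 2) • (Complex.I • legTorus n β x) =
        κ • legTorusGrad n β 1 x := by
  have hc := h.cos_pos
  have hcc : ((cos β : ℝ) : ℂ) ≠ 0 := by exact_mod_cast hc.ne'
  -- `s₀` and `s₁` are the amplitudes of the two second derivatives in the first two slots; `a` and
  -- `c` are the amplitudes of the Laplacian.
  let a : ℝ := -(sin β * (1 + cos β ^ 2) * (√2)⁻¹)
  let c : ℝ := -(sin β ^ 4 / cos β)
  let s₀ : ℂ := -((sin β * (√2)⁻¹ : ℝ) : ℂ)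
  let s₁ : ℂ := -((sin β * cos β ^ 2 * (√2)⁻¹ : ℝ) : ℂ)
  have hsum : ∀ x : Torus R, toral n s₀ s₀ 0 x + toral n s₁ s₁ c x = toral n a a c x := by
    intro x
    ext i
    fin_cases i <;> simp [toral, s₀, s₁, a, c] <;> ring
  -- The third coordinate forces `-sin⁴β/cos β + 2 sin²β cos β = -κ sin²β`; with this `κ` the other
  -- two agree because `sin² + cos² = 1`.
  refine ⟨![toral n s₀ s₀ 0, toral n s₁ s₁ c], (sin β ^ 2 - 2 * cos β ^ 2) / cos β, ?_, ?_, ?_⟩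
  · intro i
    fin_cases i <;> exact continuous_toral _ _ _ _
  · intro i x
    fin_cases i
    · simp only [Fin.zero_eta, legTorusGrad_zero]
      refine (hasDerivAt_toral_zero n _ _ _ x).congr_deriv ?_
      simp only [Matrix.cons_val_zero, s₀]
      congr 1 <;> linear_combination ((sin β * (√2)⁻¹ : ℝ) : ℂ) * Complex.I_mul_I
    · simp only [Fin.mk_one, legTorusGrad_one]
      refine (hasDerivAt_toral_one n _ _ _ h.pos.ne' x).congr_deriv ?_
      have h1 : (n : ℂ) * Complex.I / R = (cos β : ℝ) * Complex.I := by
        rw [← h.div_eq]; ring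
      have e : ∀ t : ℂ, t * Complex.I * ((cos β : ℝ) * Complex.I) = -(t * (cos β : ℝ)) := by
        intro t; linear_combination t * ((cos β : ℝ) : ℂ) * Complex.I_mul_I
      have e2 : -(((sin β ^ 2 : ℝ) : ℂ) * Complex.I) * (-Complex.I / R) = (c : ℂ) := by
        rw [div_eq_mul_inv, h.inv_eq]
        simp only [c]
        push_cast at hcc ⊢
        field_simp
        rw [Complex.I_sq]
        ring
      simp only [Matrix.cons_val_one, Matrix.cons_val_zero, h1, e, e2, s₁]
      congr 1 <;> push_cast <;> ring
  · intro x
    simp only [Matrix.cons_val_zero, Matrix.cons_val_one]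
    have hI : Complex.I • toral n ((sin β * (√2)⁻¹ : ℝ) : ℂ) ((sin β * (√2)⁻¹ : ℝ) : ℂ)
        ((cos β : ℝ) : ℂ) x = toral n (Complex.I * ((sin β * (√2)⁻¹ : ℝ) : ℂ))
          (Complex.I * ((sin β * (√2)⁻¹ : ℝ) : ℂ)) (Complex.I * ((cos β : ℝ) : ℂ)) x := by
      ext i
      fin_cases i <;> simp [toral] <;> ring
    have hr := inv_sqrt_two_sq
    have hsc := Real.sin_sq_add_cos_sq β
    refine ⟨?_, ?_, ?_⟩
    · rw [hsum, legTorus_eq, inner_toral]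
      simp only [Complex.ofReal_re, Complex.ofReal_im, a, c]
      field_simp
      have : √2 ^ 2 = (2 : ℝ) := Real.sq_sqrt (by norm_num)
      rw [this]
      linear_combination -(sin β ^ 2 * 2) * hsc
    · rw [hsum, legTorus_eq, hI, inner_toral]
      simp
    · rw [hsum, legTorus_eq, legTorusGrad_one]
      ext i
      have hscc : Complex.sin β ^ 2 + Complex.cos β ^ 2 = 1 := Complex.sin_sq_add_cos_sq _
      push_cast at hcc
      fin_cases i
      · simp [toral, a]
        generalize Complex.sin β = S at *
        generalize Complex.cos β = C at *
        generalize (x.1.toCircle : ℂ) * x.2.toCircle ^ n = p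
        field_simp
        linear_combination S * p * hscc
      · simp [toral, a]
        generalize Complex.sin β = S at *
        generalize Complex.cos β = C at *
        generalize (x.1.toCircle : ℂ)⁻¹ * x.2.toCircle ^ n = p
        field_simp
        linear_combination S * p * hscc
      · simp [toral, c]
        field_simp
        ring


/-! ### Stationarity of the homogeneous tori -/

theorem continuous_legTorus : Continuous (legTorus n β : Torus R → E) := by
  rw [legTorus_eq]; exact continuous_toral _ _ _ _

theorem continuous_legTorusGrad (i : Fin 2) : Continuous (legTorusGrad n β i : Torus R → E) := by
  fin_cases i
  · simp only [Fin.zero_eta, legTorusGrad_zero]; exact continuous_toral _ _ _ _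
  · simp only [Fin.mk_one, legTorusGrad_one]; exact continuous_toral _ _ _ _

theorem norm_legTorus (x : Torus R) : ‖legTorus n β x‖ = 1 := norm_framePt _ _

theorem legTorusGrad_zero_apply (x : Torus R) :
    legTorusGrad n β 0 x = sin β • frame₁ (phases n x) := rfl

theorem legTorusGrad_one_apply (x : Torus R) :
    legTorusGrad n β 1 x = sin β • frame₂ β (phases n x) := rfl

theorem tendsto_legTorus_sphere (y : Torus R) :
    Tendsto (legTorus n β : Torus R → E) (𝓝 y) (𝓝[Metric.sphere 0 1] (legTorus n β y)) :=
  tendsto_nhdsWithin_iff.2 ⟨continuous_legTorus.tendsto y,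
    Eventually.of_forall fun x => by simp [norm_legTorus]⟩

/-- The integrand is `∑ ∂ᵢ⟨W, ∂ᵢu⟩ - ⟨W, Δu⟩`, and `⟨W, Δu⟩ = -(κ/2) ∂_φ(F ∘ u)` with constant `κ`.
Every term is a derivative of a function vanishing near the frontier of `U`. -/
theorem setIntegral_legTorus_eq_zero (h : IsConformalParam n β R) {F : E → ℝ}
    (hF : ContDiff ℝ ∞ F) {U : Set (Torus R)} (hU : IsOpen U)
    (h0 : ∀ y ∈ frontier U, ∀ᶠ q in 𝓝[Metric.sphere 0 1] (legTorus n β y), F q = 0) :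
    ∫ x in U, ∑ i, inner ℝ (fderiv ℝ (hamField F) (legTorus n β x) (legTorusGrad n β i x))
      (legTorusGrad n β i x) ∂(Torus.area R) = 0 := by
  have := fact_pos_mul h.pos
  obtain ⟨S, κ, hSc, hS, hlap⟩ := legTorus_laplacian h
  have hW := contDiff_hamField hF
  have hWd : Differentiable ℝ (hamField F) := hW.differentiable (by simp)
  have hW' := continuous_fderiv_hamField hF
  have hFd : Differentiable ℝ F := hF.differentiable (by simp)
  have hF' : Continuous (fderiv ℝ F) := hF.continuous_fderiv (by simp)
  let u : Torus R → E := legTorus n β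
  let G : Fin 2 → Torus R → E := legTorusGrad n β
  have huc : Continuous u := continuous_legTorus
  have hGc : ∀ i, Continuous (G i) := continuous_legTorusGrad
  let g : Fin 2 → Torus R → ℝ := fun i x => inner ℝ (hamField F (u x)) (G i x)
  let g' : Fin 2 → Torus R → ℝ := fun i x =>
    inner ℝ (hamField F (u x)) (S i x) + inner ℝ (fderiv ℝ (hamField F) (u x) (G i x)) (G i x)
  have hgc : ∀ i, Continuous (g i) := fun i => (hW.continuous.comp huc).inner (hGc i)
  have hg'c : ∀ i, Continuous (g' i) := fun i =>
    ((hW.continuous.comp huc).inner (hSc i)).add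
      (((hW'.comp huc).clm_apply (hGc i)).inner (hGc i))
  have e0 : ∀ x : Torus R, ∀ i, x + Torus.mk R ((0 : ℝ) • coordDir i) = x := by
    intro x i
    rw [zero_smul]
    exact add_zero x
  have hgd : ∀ i x, HasDerivAt (fun s : ℝ => g i (x + Torus.mk R (s • coordDir i))) (g' i x) 0 := by
    intro i x
    have h1 : HasDerivAt (fun s : ℝ => hamField F (u (x + Torus.mk R (s • coordDir i))))
        (fderiv ℝ (hamField F) (u x) (G i x)) 0 := by
      refine HasFDerivAt.comp_hasDerivAt_of_eq (0 : ℝ) (hWd (u x)).hasFDerivAt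
        (hasDerivAt_legTorus h i x) ?_
      simp only [u, e0]
    have h2 := h1.inner ℝ (hS i x)
    simpa only [e0] using h2
  let k : Torus R → ℝ := fun x => F (u x)
  let k' : Torus R → ℝ := fun x => fderiv ℝ F (u x) (G 1 x)
  have hkd : ∀ x, HasDerivAt (fun s : ℝ => k (x + Torus.mk R (s • coordDir 1))) (k' x) 0 := by
    intro x
    refine HasFDerivAt.comp_hasDerivAt_of_eq (0 : ℝ) (hFd (u x)).hasFDerivAt
      (hasDerivAt_legTorus h 1 x) ?_
    simp only [u, e0]
  have hkc : Continuous k := hF.continuous.comp huc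
  have hk'c : Continuous k' := (hF'.comp huc).clm_apply (hGc 1)
  have hev : ∀ y ∈ frontier U, ∀ᶠ x in 𝓝 y, hamField F (u x) = 0 ∧ F (u x) = 0 := by
    intro y hy
    -- For `W` to vanish at the points near `y`, `F` must vanish near each of them, hence the
    -- doubled quantifier.
    have h1 := (tendsto_legTorus_sphere y).eventually (eventually_eventually_nhdsWithin.2 (h0 y hy))
    have h2 := (tendsto_legTorus_sphere y).eventually (h0 y hy)
    filter_upwards [h1, h2] with x hx hx2
    exact ⟨hamField_eq_zero_of_eventually_sphere (hFd _) (norm_legTorus x) hx, hx2⟩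
  have I : ∀ i, ∫ x in U, g' i x ∂(Torus.area R) = 0 := fun i =>
    setIntegral_torus_hasDerivAt h.pos i hU (hgc i) (hg'c i) (hgd i) fun y hy => by
      filter_upwards [hev y hy] with x hx
      simp [g, hx.1]
  have I2 : ∫ x in U, k' x ∂(Torus.area R) = 0 :=
    setIntegral_torus_hasDerivAt h.pos 1 hU hkc hk'c hkd fun y hy => by
      filter_upwards [hev y hy] with x hx
      exact hx.2
  have key : ∀ x, ∑ i, inner ℝ (fderiv ℝ (hamField F) (u x) (G i x)) (G i x) =
      g' 0 x + g' 1 x + κ / 2 * k' x := by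
    intro x
    obtain ⟨h1, h2, h3⟩ := hlap x
    have h4 := inner_hamField (F := F) h1 h2
    rw [h3, inner_add_right, map_smul, smul_eq_mul] at h4
    simp only [Fin.sum_univ_two, g', k', u, G]
    linear_combination -h4
  have hint : ∀ f : Torus R → ℝ, Continuous f → IntegrableOn f U (Torus.area R) := by
    intro f hf
    rw [torus_area_eq_volume]
    obtain ⟨C, hC⟩ := isCompact_univ.exists_bound_of_continuousOn hf.continuousOn
    exact (Integrable.of_bound hf.measurable.aestronglyMeasurable C
      (Eventually.of_forall fun x => hC x trivial)).integrableOn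
  calc _ = ∫ x in U, (g' 0 x + g' 1 x + κ / 2 * k' x) ∂(Torus.area R) :=
        integral_congr_ae (Eventually.of_forall key)
    _ = 0 := by
      rw [integral_add (f := fun x => g' 0 x + g' 1 x) (hint _ ((hg'c 0).add (hg'c 1)))
        ((hint _ hk'c).const_mul _), integral_add (hint _ (hg'c 0)) (hint _ (hg'c 1)), integral_const_mul, I, I, I2]
      simp

theorem span_legTorusGrad (h : IsConformalParam n β R) (x : Torus R) :
    Submodule.span ℝ {legTorusGrad n β 0 x, legTorusGrad n β 1 x} =
      (framePlane (β, phases n x)).plane := by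
  have hs := h.sin_pos.ne'
  simp only [legTorusGrad_zero_apply, legTorusGrad_one_apply, framePlane]
  rw [Submodule.span_insert, Submodule.span_insert,
    Submodule.span_singleton_smul_eq (IsUnit.mk0 _ hs),
    Submodule.span_singleton_smul_eq (IsUnit.mk0 _ hs)]

theorem norm_legTorusGrad (h : IsConformalParam n β R) (i : Fin 2) (x : Torus R) :
    ‖legTorusGrad n β i x‖ = sin β := by
  fin_cases i <;>
    simp [legTorusGrad, norm_smul, norm_frame₁, norm_frame₂, abs_of_pos h.sin_pos]

theorem inner_legTorusGrad (x : Torus R) :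
    inner ℝ (legTorusGrad n β 0 x) (legTorusGrad n β 1 x) = 0 := by
  rw [legTorusGrad_zero_apply, legTorusGrad_one_apply, inner_smul_left, inner_smul_right,
    (frame_inner _ _).2.2.2.1]
  simp

theorem contactForm_legTorusGrad (i : Fin 2) (x : Torus R) :
    contactForm (legTorus n β x) (legTorusGrad n β i x) = 0 := by
  fin_cases i
  · simp [contactForm, legTorusGrad, legTorus, inner_smul_right,
      (frame_inner β (phases n x)).2.2.2.2.2.2.1]
  · simp [contactForm, legTorusGrad, legTorus, inner_smul_right,
      (frame_inner β (phases n x)).2.2.2.2.2.2.2.1]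

theorem areaElement_legTorusGrad (h : IsConformalParam n β R) (x : Torus R) :
    areaElement (legTorusGrad n β 0 x) (legTorusGrad n β 1 x) = sin β ^ 2 := by
  rw [areaElement, inner_legTorusGrad, norm_legTorusGrad h, norm_legTorusGrad h]
  rw [show sin β ^ 2 * sin β ^ 2 - 0 ^ 2 = (sin β ^ 2) ^ 2 by ring, Real.sqrt_sq (sq_nonneg _)]

theorem divPlane_framePlane_mul (W : E → E) (x : Torus R) :
    divPlane W (framePlane (β, phases n x)).plane (framePlane (β, phases n x)).pt * sin β ^ 2 =
      ∑ i, inner ℝ (fderiv ℝ W (legTorus n β x) (legTorusGrad n β i x)) (legTorusGrad n β i x) := by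
  simp only [framePlane]
  rw [divPlane_span_pair W _ (norm_frame₁ _) (norm_frame₂ _ _) (frame_inner _ _).2.2.2.1,
    Fin.sum_univ_two, legTorusGrad_zero_apply, legTorusGrad_one_apply]
  simp only [map_smul, inner_smul_left, inner_smul_right, legTorus]
  simp
  ring

theorem integral_divPlane_legTorus (h : IsConformalParam n β R) {F : E → ℝ}
    (hF : ContDiff ℝ ∞ F) :
    ∫ x : Torus R, divPlane (hamField F) (framePlane (β, phases n x)).plane
      (framePlane (β, phases n x)).pt * sin β ^ 2 ∂(Torus.area R) = 0 := by
  have := setIntegral_legTorus_eq_zero h hF isOpen_univ (by simp)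
  simpa only [divPlane_framePlane_mul, setIntegral_univ] using this

theorem isHamiltonianStationary_legTorus (h : IsConformalParam n β R) :
    IsHamiltonianStationary R (legTorus n β) := by
  intro F hF
  rw [← integral_divPlane_legTorus h hF]
  refine integral_congr_ae (Eventually.of_forall fun x => ?_)
  simp only [pd_legTorus h, areaElement_legTorusGrad h, span_legTorusGrad h]
  rfl

/-- The third coordinate has frequency one and determines `w`; the first coordinate then determines
`z`. -/
theorem injective_legTorus (h : IsConformalParam n β R) :
    Function.Injective (legTorus n β : Torus R → E) := by
  have := h.pos
  have hs := h.sin_pos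
  intro x y hxy
  have hcc : ((cos β : ℝ) : ℂ) ≠ 0 := by exact_mod_cast h.cos_pos.ne'
  have hss : ((sin β * (√2)⁻¹ : ℝ) : ℂ) ≠ 0 := by
    have : sin β * (√2)⁻¹ ≠ 0 := by positivity
    exact_mod_cast this
  have e2 := congrArg (fun p : E => p 2) hxy
  have e0 := congrArg (fun p : E => p 0) hxy
  simp only [legTorus, framePt, phases, Matrix.cons_val_zero, Matrix.cons_val] at e0 e2
  have e2' : x.2.toCircle = y.2.toCircle :=
    inv_injective (Circle.coe_injective (mul_left_cancel₀ hcc e2))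
  have e0' : x.1.toCircle = y.1.toCircle := by
    have := Circle.coe_injective (mul_left_cancel₀ hss e0)
    rw [e2'] at this
    exact mul_right_cancel this
  exact Prod.ext (AddCircle.injective_toCircle (by positivity) e0')
    (AddCircle.injective_toCircle (by positivity) e2')

theorem isConformalLegendrianEmbedding_legTorus (h : IsConformalParam n β R) :
    IsConformalLegendrianEmbedding R (legTorus n β) where
  smooth := by rw [legTorus_eq]; exact smoothOnTorus_toral _ _ _ _ _
  norm_eq := norm_legTorus
  isEmbedding := by
    have := fact_pos_mul h.pos
    exact (continuous_legTorus.isClosedEmbedding (injective_legTorus h)).isEmbedding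
  immersion x := by
    rw [pd_legTorus h, pd_legTorus h]
    have hs := h.sin_pos
    refine linearIndependent_of_orthogonal ?_ ?_ (inner_legTorusGrad x) <;>
    · rw [← norm_pos_iff, norm_legTorusGrad h]
      exact hs
  conformal x := by
    rw [pd_legTorus h, pd_legTorus h, norm_legTorusGrad h, norm_legTorusGrad h]
    exact ⟨rfl, inner_legTorusGrad x⟩
  legendrian x i := by
    rw [pd_legTorus h]
    exact contactForm_legTorusGrad i x

theorem isSobolevGradient_legTorus (h : IsConformalParam n β R) :
    IsSobolevGradient R (legTorus n β) (legTorusGrad n β) where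
  memLp := by
    have := fact_pos_mul h.pos
    rw [torus_area_eq_volume]
    exact MemLp.of_bound continuous_legTorus.aestronglyMeasurable 1
      (Eventually.of_forall fun x => (norm_legTorus x).le)
  memLp_grad i := by
    have := fact_pos_mul h.pos
    rw [torus_area_eq_volume]
    exact MemLp.of_bound (continuous_legTorusGrad i).aestronglyMeasurable (sin β)
      (Eventually.of_forall fun x => (norm_legTorusGrad h i x).le)
  weak i ψ hψ hψc := by
    have hψ' : Continuous fun z => fderiv ℝ ψ z (coordDir i) :=
      (hψ.continuous_fderiv (by simp)).clm_apply continuous_const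
    have hψc' : HasCompactSupport fun z => fderiv ℝ ψ z (coordDir i) :=
      hψc.fderiv_apply (𝕜 := ℝ) _
    have hu : Continuous fun z => legTorus n β (Torus.mk R z) :=
      continuous_legTorus.comp (continuous_torus_mk R)
    have hG : Continuous fun z => legTorusGrad n β i (Torus.mk R z) :=
      (continuous_legTorusGrad i).comp (continuous_torus_mk R)
    have key := integral_bilinear_hasLineDerivAt_right_eq_neg_left_of_integrable
      (μ := (volume : Measure (ℝ × ℝ))) (f := ψ) (f' := fun z => fderiv ℝ ψ z (coordDir i))
      (g := fun z => legTorus n β (Torus.mk R z)) (g' := fun z => legTorusGrad n β i (Torus.mk R z))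
      (v := coordDir i) (B := ContinuousLinearMap.lsmul ℝ ℝ)
      ((hψ'.smul hu).integrable_of_hasCompactSupport hψc'.smul_right)
      ((hψ.continuous.smul hG).integrable_of_hasCompactSupport hψc.smul_right)
      ((hψ.continuous.smul hu).integrable_of_hasCompactSupport hψc.smul_right)
      (fun x _ => ((hψ.differentiable (by simp)) x).hasFDerivAt.hasLineDerivAt _)
      (fun x _ => hasDerivAt_legTorus h i (Torus.mk R x))
    simp only [ContinuousLinearMap.lsmul_apply] at key
    rw [key, neg_neg]

theorem isPHSLV_legTorus (h : IsConformalParam n β R) :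
    IsPHSLV R (legTorus n β) (fun _ => 1) where
  continuous := continuous_legTorus
  norm_eq := norm_legTorus
  measurable_mult := aemeasurable_const
  one_le_mult := Eventually.of_forall fun _ => le_rfl
  bounded_mult := ⟨1, Eventually.of_forall fun _ => le_rfl⟩
  stationary := by
    refine ⟨legTorusGrad n β, isSobolevGradient_legTorus h,
      Eventually.of_forall fun x i => contactForm_legTorusGrad i x,
      Eventually.of_forall fun x => ⟨by rw [norm_legTorusGrad h, norm_legTorusGrad h],
        inner_legTorusGrad x⟩, fun f hf _ => Eventually.of_forall fun t F hF h0 => ?_⟩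
    -- Smoothness is stated on the cover; continuity descends because the covering map is a quotient
    -- map.
    have hfc : Continuous f := by
      have hq : IsOpenQuotientMap (Torus.mk R) :=
        (QuotientAddGroup.isOpenQuotientMap_mk).prodMap (QuotientAddGroup.isOpenQuotientMap_mk)
      exact hq.isQuotientMap.continuous_iff.2 hf.continuous
    -- The frontier of `{f > t}` lies in the level set `f = t`, so every `t` works, not merely
    -- almost every one.
    have := setIntegral_legTorus_eq_zero h hF (isOpen_lt continuous_const hfc)
      fun y hy => h0 y (frontier_lt_subset_eq continuous_const hfc hy).symm
    simpa using this

/-! ### The varifolds of the homogeneous tori -/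

/-- The varifold induced by the homogeneous torus. -/
def torusVarifold (n : ℕ) (β R : ℝ) : Measure LegGr :=
  Measure.map (fun x : Torus R => framePlane (β, phases n x))
    (ENNReal.ofReal (sin β ^ 2) • Torus.area R)

theorem continuous_framePlane_phases :
    Continuous fun x : Torus R => framePlane (β, phases n x) :=
  continuous_framePlane.comp (continuous_const.prodMk (continuous_phases n))

theorem torusVarifold_apply {B : Set LegGr} (hB : MeasurableSet B) :
    torusVarifold n β R B = ENNReal.ofReal (sin β ^ 2) *
      Torus.area R ((fun x : Torus R => framePlane (β, phases n x)) ⁻¹' B) := by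
  rw [torusVarifold, Measure.map_apply continuous_framePlane_phases.measurable hB]
  rfl

/-- A point of the bundle is its base point and plane, so the existential sets in the definitions
are preimages under the Gauss map. -/
theorem setOf_exists_mem_eq_preimage {X : Type*} (L : X → LegGr) (B : Set LegGr) {p : X → E}
    {P : X → Submodule ℝ E} (hp : ∀ x, p x = (L x).pt) (hP : ∀ x, P x = (L x).plane) :
    {x | ∃ b ∈ B, b.pt = p x ∧ b.plane = P x} = L ⁻¹' B := by
  ext x
  constructor
  · rintro ⟨b, hb, h1, h2⟩
    have : b = L x := LegGr.ext (h1.trans (hp x)) (h2.trans (hP x))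
    rw [mem_preimage, ← this]
    exact hb
  · intro hx
    exact ⟨L x, hx, (hp x).symm, (hP x).symm⟩

theorem isInducedVarifold_legTorus (h : IsConformalParam n β R) :
    IsInducedVarifold R (legTorus n β) (fun _ => 1) (torusVarifold n β R) := by
  refine ⟨legTorusGrad n β, isSobolevGradient_legTorus h, fun B hB => ?_⟩
  rw [setOf_exists_mem_eq_preimage (fun x : Torus R => framePlane (β, phases n x)) B
    (p := legTorus n β) (fun _ => rfl) (span_legTorusGrad h), torusVarifold_apply hB]
  simp [norm_legTorusGrad h]

theorem isHSLV_torusVarifold (h : IsConformalParam n β R) : IsHSLV (torusVarifold n β R) := by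
  have := fact_pos_mul h.pos
  refine ⟨?_, fun F hF => ?_⟩
  · have : IsFiniteMeasure (ENNReal.ofReal (sin β ^ 2) • Torus.area R) := by
      rw [torus_area_eq_volume]
      exact Measure.smul_finite _ ENNReal.ofReal_ne_top
    rw [torusVarifold]
    infer_instance
  · have hc := continuous_divPlane (continuous_fderiv_hamField hF)
    rw [torusVarifold, integral_map continuous_framePlane_phases.measurable.aemeasurable
      hc.measurable.aestronglyMeasurable, integral_smul_measure]
    have h2 := integral_divPlane_legTorus h hF
    rw [integral_mul_const] at h2
    rw [(mul_eq_zero.1 h2).resolve_right (by have := h.sin_pos; positivity), smul_zero]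

theorem isIntegralVarifold_torusVarifold (h : IsConformalParam n β R) :
    IsIntegralVarifold (torusVarifold n β R) := by
  have hRp := h.pos
  let Q : Set (ℝ × ℝ) := Ioc 0 (2 * π) ×ˢ Ioc 0 (2 * π * R)
  have hQ : MeasurableSet Q := measurableSet_Ioc.prod measurableSet_Ioc
  let g : ℝ × ℝ → E := fun z => legTorus n β (Torus.mk R z)
  have hg : ContDiff ℝ ∞ g := (isConformalLegendrianEmbedding_legTorus h).smooth
  have hgd : ∀ z i, fderiv ℝ g z (coordDir i) = legTorusGrad n β i (Torus.mk R z) := by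
    intro z i
    have h1 := ((hg.differentiable (by simp)) z).hasFDerivAt.hasLineDerivAt (coordDir i)
    exact HasDerivAt.unique h1 (hasDerivAt_legTorus h i (Torus.mk R z))
  have h0 : ∀ z, fderiv ℝ g z (1, 0) = legTorusGrad n β 0 (Torus.mk R z) := fun z => hgd z 0
  have h1 : ∀ z, fderiv ℝ g z (0, 1) = legTorusGrad n β 1 (Torus.mk R z) := fun z => hgd z 1
  have hrange : ∀ z, LinearMap.range (fderiv ℝ g z).toLinearMap =
      (framePlane (β, phases n (Torus.mk R z))).plane := by
    intro z
    rw [← span_legTorusGrad h, ← h0, ← h1]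
    ext w
    rw [LinearMap.mem_range, Submodule.mem_span_pair]
    constructor
    · rintro ⟨⟨a, b⟩, rfl⟩
      refine ⟨a, b, ?_⟩
      rw [← map_smul, ← map_smul, ← map_add]
      simp
    · rintro ⟨a, b, rfl⟩
      refine ⟨(a, b), ?_⟩
      rw [← map_smul, ← map_smul, ← map_add]
      simp
  have hinj : InjOn g Q := by
    intro z hz z' hz' hzz'
    have e := injective_legTorus h hzz'
    have e1 : (z.1 : AddCircle (2 * π)) = z'.1 := congrArg Prod.fst e
    have e2 : (z.2 : AddCircle (2 * π * R)) = z'.2 := congrArg Prod.snd e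
    have := fact_pos_mul hRp
    refine Prod.ext ?_ ?_
    · exact (AddCircle.coe_eq_coe_iff_of_mem_Ioc (a := 0) (by simpa using hz.1)
        (by simpa using hz'.1)).1 e1
    · exact (AddCircle.coe_eq_coe_iff_of_mem_Ioc (a := 0) (by simpa using hz.2)
        (by simpa using hz'.2)).1 e2
  -- A single piece of multiplicity one, the half-open fundamental domain, suffices; the other
  -- pieces are empty.
  refine ⟨fun i => if i = 0 then 1 else 0, fun i => if i = 0 then Q else ∅, fun _ => g,
    fun i => ⟨by dsimp only; split_ifs; exacts [hQ, MeasurableSet.empty], hg.of_le (by exact_mod_cast le_top),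
      ?_, ?_⟩, fun B hB => ?_⟩
  · dsimp only
    split_ifs
    exacts [hinj, injOn_empty _]
  · intro z _
    refine ⟨norm_legTorus _, ?_⟩
    rw [hrange]
    exact (framePlane (β, phases n (Torus.mk R z))).legendrian
  · rw [tsum_eq_single 0 (by intro i hi; simp [hi])]
    have hset : {z | z ∈ Q ∧ ∃ b ∈ B, b.pt = g z ∧
        b.plane = LinearMap.range (fderiv ℝ g z).toLinearMap} =
        (Torus.mk R ⁻¹' ((fun x : Torus R => framePlane (β, phases n x)) ⁻¹' B)) ∩ Q := by
      rw [← preimage_comp, inter_comm]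
      exact congrArg (Q ∩ ·) (setOf_exists_mem_eq_preimage
        ((fun x : Torus R => framePlane (β, phases n x)) ∘ Torus.mk R) B (p := g) (fun _ => rfl)
        hrange)
    have hmeas : MeasurableSet ((fun x : Torus R => framePlane (β, phases n x)) ⁻¹' B) :=
      continuous_framePlane_phases.measurable hB
    simp only [if_true]
    rw [hset, torusVarifold_apply hB, Torus.area,
      Measure.map_apply (continuous_torus_mk R).measurable hmeas,
      Measure.restrict_apply ((continuous_torus_mk R).measurable hmeas)]
    simp only [h0, h1, areaElement_legTorusGrad h]
    simp [Q]

/-! ### The length measure of the Hopf fiber -/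

theorem mem_hopfFiber_exp (t : ℝ) : (!₂[0, 0, Complex.exp (Complex.I * t)] : E) ∈ hopfFiber := by
  refine ⟨rfl, rfl, ?_⟩
  simp [mul_comm Complex.I, Complex.norm_exp_ofReal_mul_I]

/-- The parametrization of the Hopf fiber by arclength. -/
def hopfParam (t : ℝ) : hopfFiber := ⟨_, mem_hopfFiber_exp t⟩

theorem dist_hopfParam (s t : ℝ) : dist (hopfParam s) (hopfParam t) = |2 * sin ((s - t) / 2)| := by
  have h : Complex.exp (Complex.I * s) - Complex.exp (Complex.I * t) =
      Complex.exp ((t : ℝ) * Complex.I) * (Complex.exp (Complex.I * ((s - t : ℝ) : ℂ)) - 1) := by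
    rw [mul_sub, ← Complex.exp_add, mul_one, mul_comm ((t : ℝ) : ℂ)]
    congr 2
    push_cast
    ring
  rw [Subtype.dist_eq, dist_eq_norm, EuclideanSpace.norm_eq, Fin.sum_univ_three]
  simp only [hopfParam, PiLp.sub_apply, Matrix.cons_val_zero, Matrix.cons_val_one, Matrix.cons_val,
    sub_zero, norm_zero]
  rw [h, norm_mul, Complex.norm_exp_ofReal_mul_I, Complex.norm_exp_I_mul_ofReal_sub_one]
  simp

theorem lipschitzWith_hopfParam : LipschitzWith 1 hopfParam := by
  refine LipschitzWith.of_dist_le_mul fun s t => ?_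
  rw [dist_hopfParam, Real.dist_eq, abs_mul, abs_of_pos (two_pos : (0 : ℝ) < 2)]
  have h := Real.abs_sin_le_abs (x := (s - t) / 2)
  rw [abs_div, abs_of_pos (two_pos : (0 : ℝ) < 2)] at h
  push_cast
  linarith

/-- The chord `2 sin(x/2)` exceeds `x - x³/16`, and `x³ ≤ δx` for `0 < x ≤ δ ≤ 1`. -/
theorem one_sub_mul_dist_le_dist_hopfParam {δ s t : ℝ} (hδ : δ ≤ 1) (hst : |s - t| ≤ δ) :
    (1 - δ) * |s - t| ≤ dist (hopfParam s) (hopfParam t) := by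
  rw [dist_hopfParam, abs_mul, abs_of_pos (two_pos : (0 : ℝ) < 2)]
  have key : ∀ x : ℝ, 0 < x → x ≤ δ → (1 - δ) * x ≤ 2 * sin (x / 2) := by
    intro x hx hxδ
    have h := Real.sin_gt_sub_cube (x := x / 2) (by positivity)
    have h2 : x ^ 3 ≤ x * δ := by
      have : x ^ 2 ≤ δ := by nlinarith
      nlinarith
    nlinarith
  rcases lt_trichotomy (s - t) 0 with h | h | h
  · have := key (-(s - t)) (by linarith) (by rwa [abs_of_neg h] at hst)
    rw [abs_of_neg h]
    rw [neg_div, Real.sin_neg] at this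
    have h2 := neg_abs_le (sin ((s - t) / 2))
    linarith
  · simp [h]
  · have := key (s - t) h (by rwa [abs_of_pos h] at hst)
    rw [abs_of_pos h]
    have h2 := le_abs_self (sin ((s - t) / 2))
    linarith

theorem injOn_hopfParam : InjOn hopfParam (Ioc 0 (2 * π)) := by
  intro s hs t ht hst
  have h : dist (hopfParam s) (hopfParam t) = 0 := by rw [hst, dist_self]
  rw [dist_hopfParam, abs_eq_zero, mul_eq_zero] at h
  have h0 := h.resolve_left two_ne_zero
  have h1 := (Real.sin_eq_zero_iff_of_lt_of_lt (by linarith [hs.1, ht.2]) (by linarith [hs.2, ht.1])).1 h0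
  linarith

theorem surjOn_hopfParam : hopfParam '' Ioc 0 (2 * π) = univ := by
  rw [eq_univ_iff_forall]
  rintro ⟨p, h0, h1, h2⟩
  have hper : ∃ t ∈ Ioc 0 (2 * π), Complex.exp ((t : ℝ) * Complex.I) = p 2 := by
    have hp : Function.Periodic (fun t : ℝ => Complex.exp ((t : ℝ) * Complex.I)) (2 * π) := by
      intro t
      have := Complex.exp_mul_I_periodic (t : ℂ)
      simpa using this
    obtain ⟨t, ht, hte⟩ := hp.exists_mem_Ioc Real.two_pi_pos (Complex.arg (p 2)) 0
    refine ⟨t, by simpa using ht, ?_⟩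
    rw [← hte]
    have := Complex.norm_mul_exp_arg_mul_I (p 2)
    rwa [h2, Complex.ofReal_one, one_mul] at this
  obtain ⟨t, ht, hte⟩ := hper
  refine ⟨t, ht, Subtype.ext ?_⟩
  ext i
  fin_cases i
  · exact h0.symm
  · exact h1.symm
  · simp [hopfParam, ← hte, mul_comm]

/-- On a set of diameter at most `δ` the inverse of the parametrization is Lipschitz with constant
`(1 - δ)⁻¹`. -/
theorem volume_le_hausdorffMeasure_hopfParam {δ : ℝ} (hδ1 : δ < 1) {I : Set ℝ}
    (hI : ∀ s ∈ I, ∀ t ∈ I, |s - t| ≤ δ) :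
    ENNReal.ofReal (1 - δ) * volume I ≤ μH[1] (hopfParam '' I) := by
  have hpos : 0 < 1 - δ := by linarith
  have hinj : InjOn hopfParam I := by
    intro s hs t ht hst
    have h := one_sub_mul_dist_le_dist_hopfParam hδ1.le (hI s hs t ht)
    rw [hst, dist_self] at h
    have : |s - t| ≤ 0 := by
      by_contra hc
      push Not at hc
      nlinarith
    exact sub_eq_zero.1 (abs_nonpos_iff.1 this)
  have hL : LipschitzOnWith (Real.toNNReal (1 - δ)⁻¹) (Function.invFunOn hopfParam I)
      (hopfParam '' I) := by
    refine LipschitzOnWith.of_dist_le_mul ?_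
    rintro _ ⟨s, hs, rfl⟩ _ ⟨t, ht, rfl⟩
    rw [hinj.leftInvOn_invFunOn hs, hinj.leftInvOn_invFunOn ht, Real.coe_toNNReal _ (by positivity),
      Real.dist_eq, inv_mul_eq_div, le_div_iff₀ hpos, mul_comm]
    exact one_sub_mul_dist_le_dist_hopfParam hδ1.le (hI s hs t ht)
  have h := hL.hausdorffMeasure_image_le zero_le_one
  rw [hinj.leftInvOn_invFunOn.image_image, hausdorffMeasure_real, ENNReal.rpow_one] at h
  calc _ ≤ ENNReal.ofReal (1 - δ) * (ENNReal.ofReal (1 - δ)⁻¹ * μH[1] (hopfParam '' I)) := by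
        gcongr; exact h
    _ = _ := by
        rw [← mul_assoc, ← ENNReal.ofReal_mul hpos.le, mul_inv_cancel₀ hpos.ne',
          ENNReal.ofReal_one, one_mul]

theorem ofReal_two_pi_le_hausdorffMeasure :
    ENNReal.ofReal (2 * π) ≤ (μH[1] : Measure hopfFiber) univ := by
  have key : ∀ δ ∈ Ioo (0 : ℝ) 1,
      ENNReal.ofReal (1 - δ) * ENNReal.ofReal (2 * π) ≤ (μH[1] : Measure hopfFiber) univ := by
    intro δ hδ
    -- Pieces of length at most `δ` have disjoint images; their lower bounds add up, and `δ → 0`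
    -- removes the loss.
    let I : ℤ → Set ℝ := fun j => Ioc 0 (2 * π) ∩ Ioc (j • δ) ((j + 1) • δ)
    have hIm : ∀ j, MeasurableSet (I j) := fun j => measurableSet_Ioc.inter measurableSet_Ioc
    have hdisj : Pairwise (Function.onFun Disjoint I) := fun i j hij =>
      ((pairwise_disjoint_Ioc_zsmul δ) hij).mono inter_subset_right inter_subset_right
    have hU : ⋃ j, I j = Ioc 0 (2 * π) := by
      rw [← inter_iUnion, iUnion_Ioc_zsmul hδ.1, inter_univ]
    have hvol : ENNReal.ofReal (2 * π) = ∑' j, volume (I j) := by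
      rw [← measure_iUnion hdisj hIm, hU, Real.volume_Ioc, sub_zero]
    have hsub : ∀ j, I j ⊆ Ioc 0 (2 * π) := fun j => inter_subset_left
    have hdisj' : Pairwise (Function.onFun Disjoint fun j => hopfParam '' I j) := fun i j hij =>
      disjoint_iff_inter_eq_empty.2 (by
        rw [← injOn_hopfParam.image_inter (hsub i) (hsub j),
          disjoint_iff_inter_eq_empty.1 (hdisj hij), image_empty])
    have hm : ∀ j, MeasurableSet (hopfParam '' I j) := fun j =>
      (hIm j).image_of_continuousOn_injOn lipschitzWith_hopfParam.continuous.continuousOn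
        (injOn_hopfParam.mono (hsub j))
    calc _ = ∑' j, ENNReal.ofReal (1 - δ) * volume (I j) := by rw [hvol, ENNReal.tsum_mul_left]
      _ ≤ ∑' j, μH[1] (hopfParam '' I j) := by
        refine ENNReal.tsum_le_tsum fun j => volume_le_hausdorffMeasure_hopfParam hδ.2 ?_
        intro s hs t ht
        have h1 := hs.2
        have h2 := ht.2
        simp only [zsmul_eq_mul, Int.cast_add, Int.cast_one, mem_Ioc] at h1 h2
        rw [abs_le]
        constructor <;> linarith [h1.1, h1.2, h2.1, h2.2]
      _ = μH[1] (⋃ j, hopfParam '' I j) := (measure_iUnion hdisj' hm).symm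
      _ ≤ _ := measure_mono (subset_univ _)
  have hlim : Tendsto (fun δ : ℝ => ENNReal.ofReal (1 - δ) * ENNReal.ofReal (2 * π)) (𝓝[>] 0)
      (𝓝 (ENNReal.ofReal (1 - 0) * ENNReal.ofReal (2 * π))) := by
    refine ENNReal.Tendsto.mul_const ?_ (Or.inr ENNReal.ofReal_ne_top)
    refine (ENNReal.continuous_ofReal.comp (continuous_const.sub continuous_id)).continuousAt.tendsto.mono_left
      nhdsWithin_le_nhds
  rw [sub_zero, ENNReal.ofReal_one, one_mul] at hlim
  refine le_of_tendsto hlim ?_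
  filter_upwards [Ioo_mem_nhdsGT (zero_lt_one' ℝ)] with δ hδ using key δ hδ

/-- The parametrization is 1-Lipschitz, which gives one inequality; two ordered measures with the
same finite total mass coincide. -/
theorem hausdorffMeasure_hopfFiber :
    (μH[1] : Measure hopfFiber) = Measure.map hopfParam (volume.restrict (Ioc 0 (2 * π))) := by
  have hmeas : Measurable hopfParam := lipschitzWith_hopfParam.continuous.measurable
  have huniv : Measure.map hopfParam (volume.restrict (Ioc 0 (2 * π))) univ =
      ENNReal.ofReal (2 * π) := by
    rw [Measure.map_apply hmeas MeasurableSet.univ]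
    simp
  have hle : (μH[1] : Measure hopfFiber) ≤
      Measure.map hopfParam (volume.restrict (Ioc 0 (2 * π))) := by
    refine Measure.le_iff.2 fun A hA => ?_
    rw [Measure.map_apply hmeas hA, Measure.restrict_apply (hmeas hA)]
    have hAe : A = hopfParam '' (hopfParam ⁻¹' A ∩ Ioc 0 (2 * π)) := by
      rw [image_preimage_inter, surjOn_hopfParam, inter_univ]
    have h := (lipschitzWith_hopfParam.lipschitzOnWith
      (s := hopfParam ⁻¹' A ∩ Ioc 0 (2 * π))).hausdorffMeasure_image_le zero_le_one
    rw [← hAe, hausdorffMeasure_real] at h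
    simpa using h
  have hfin : IsFiniteMeasure (Measure.map hopfParam (volume.restrict (Ioc 0 (2 * π)))) :=
    ⟨by rw [huniv]; exact ENNReal.ofReal_lt_top⟩
  have hfin' := isFiniteMeasure_of_le _ hle
  refine Measure.eq_of_le_of_measure_univ_eq hle (le_antisymm (hle univ) ?_)
  rw [huniv]
  exact ofReal_two_pi_le_hausdorffMeasure

/-! ### The limit varifold as an image measure -/

/-- The third coordinate of a point of the Hopf fiber, as a point of the circle. -/
def hopfPhase (p : hopfFiber) : Circle := ⟨(p : E) 2, mem_sphere_zero_iff_norm.2 p.2.2.2⟩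

theorem continuous_hopfPhase : Continuous hopfPhase := by
  refine Continuous.subtype_mk ?_ _
  exact (PiLp.continuous_apply 2 _ 2).comp continuous_subtype_val

theorem hopfPhase_hopfParam (t : ℝ) :
    hopfPhase (hopfParam t) = AddCircle.toCircle (t : AddCircle (2 * π)) := by
  ext
  rw [AddCircle.toCircle_apply_mk, Circle.coe_exp, div_self (by positivity), one_mul]
  simp [hopfPhase, hopfParam, mul_comm]

/-- At `β = 0` the frame is the pair of coordinate directions `a`, `b` turned by 45°, so it spans
the same plane. The shift by `π / 2` undoes the factor `i` in the frame. -/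
theorem fiberPlane_eq_framePlane (p : hopfFiber) (x : ℝ × ℝ) :
    fiberPlane p x = framePlane (0, hopfPhase p * Circle.exp (x.1 - π / 2),
      hopfPhase p * Circle.exp (x.2 - π / 2), hopfPhase p) := by
  obtain ⟨p, h0, h1, h2⟩ := p
  have he : ∀ t : ℝ, Complex.I * Complex.exp (((t - π / 2 : ℝ) : ℂ) * Complex.I) =
      Complex.exp (t * Complex.I) := by
    intro t
    push_cast
    rw [sub_mul, Complex.exp_sub, Complex.exp_pi_div_two_mul_I]
    field_simp
  apply LegGr.ext
  · ext i
    fin_cases i <;> simp [fiberPlane, framePlane, framePt, hopfPhase, h0, h1]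
  · let a : E := !₂[p 2 * Complex.exp (x.1 * Complex.I), 0, 0]
    let b : E := !₂[0, p 2 * Complex.exp (x.2 * Complex.I), 0]
    have hL : (fiberPlane ⟨p, h0, h1, h2⟩ x).plane = Submodule.span ℝ {a, b} := by
      simp only [fiberPlane, rotPlane, planeTorus]
      rw [Submodule.map_span, image_pair]
      congr 2
      · ext i
        fin_cases i <;> simp [vec1, a, Complex.exp_mul_I, mul_add]
      · rw [singleton_eq_singleton_iff]
        ext i
        fin_cases i <;> simp [vec2, b, Complex.exp_mul_I, mul_add]
    have hR : (framePlane (0, hopfPhase ⟨p, h0, h1, h2⟩ * Circle.exp (x.1 - π / 2),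
        hopfPhase ⟨p, h0, h1, h2⟩ * Circle.exp (x.2 - π / 2), hopfPhase ⟨p, h0, h1, h2⟩)).plane =
        Submodule.span ℝ {(√2)⁻¹ • (a - b), (√2)⁻¹ • (a + b)} := by
      have e : ∀ t : ℝ, Complex.I * ((hopfPhase ⟨p, h0, h1, h2⟩ * Circle.exp (t - π / 2) : Circle) :
          ℂ) = p 2 * Complex.exp (t * Complex.I) := by
        intro t
        rw [← he, Circle.coe_mul, Circle.coe_exp, hopfPhase]
        ring
      simp only [framePlane]
      congr 2
      · ext i
        fin_cases i
        · simp [frame₁, a, b, e, -Circle.coe_mul, -Circle.exp_sub]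
        · simp [frame₁, a, b, e, -Circle.coe_mul, -Circle.exp_sub]
        · simp [frame₁, a, b]
      · rw [singleton_eq_singleton_iff]
        ext i
        fin_cases i
        · simp [frame₂, a, b, e, -Circle.coe_mul, -Circle.exp_sub]
        · simp [frame₂, a, b, e, -Circle.coe_mul, -Circle.exp_sub]
        · simp [frame₂, a, b]
    rw [hL, hR]
    have hs : (√2)⁻¹ * (√2)⁻¹ = (1 / 2 : ℝ) := by rw [← pow_two, inv_sqrt_two_sq]
    apply le_antisymm <;> rw [Submodule.span_le] <;> rintro w (rfl | rfl)
    · refine Submodule.mem_span_pair.2 ⟨(√2)⁻¹, (√2)⁻¹, ?_⟩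
      rw [smul_smul, smul_smul, hs]
      module
    · refine Submodule.mem_span_pair.2 ⟨-(√2)⁻¹, (√2)⁻¹, ?_⟩
      rw [smul_smul, smul_smul, neg_mul, hs]
      module
    · exact Submodule.mem_span_pair.2 ⟨(√2)⁻¹, -(√2)⁻¹, by module⟩
    · exact Submodule.mem_span_pair.2 ⟨(√2)⁻¹, (√2)⁻¹, by module⟩

/-- The Legendrian planes over the Hopf fiber that carry the limit varifold. -/
def anglesPlane (q : AddCircle (2 * π) × AddCircle (2 * π) × AddCircle (2 * π)) : LegGr :=
  framePlane (0, q.2.1.toCircle, q.2.2.toCircle, q.1.toCircle)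

theorem continuous_anglesPlane : Continuous anglesPlane := by
  have h1 := AddCircle.continuous_toCircle (T := 2 * π)
  exact continuous_framePlane.comp (continuous_const.prodMk
    ((h1.comp (continuous_fst.comp continuous_snd)).prodMk
      ((h1.comp (continuous_snd.comp continuous_snd)).prodMk (h1.comp continuous_fst))))

theorem volume_restrict_square :
    (volume : Measure (ℝ × ℝ)).restrict (Ico 0 (2 * π) ×ˢ Ico 0 (2 * π)) =
      (volume.restrict (Ioc 0 (2 * π))).prod (volume.restrict (Ioc 0 (2 * π))) := by
  rw [← Measure.restrict_congr_set (Ico_ae_eq_Ioc (a := (0 : ℝ)) (b := 2 * π)),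
    Measure.prod_restrict]
  rfl

/-- The rotation by `e^{it}` and the quarter turn translate both angles by `t - π/2`, which Haar
measure does not see. -/
theorem uniformPlanes_hopfParam (t : ℝ) : uniformPlanes (hopfParam t) =
    ENNReal.ofReal ((2 * π) ^ 2)⁻¹ • Measure.map
      (fun q : AddCircle (2 * π) × AddCircle (2 * π) => anglesPlane (t, q)) volume := by
  rw [uniformPlanes, Measure.map_smul, volume_restrict_square]
  congr 1
  have h1 := AddCircle.measurePreserving_mk (2 * π) 0
  rw [zero_add] at h1
  let a : AddCircle (2 * π) := ((t - π / 2 : ℝ) : AddCircle (2 * π))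
  have h2 : MeasurePreserving (fun q : AddCircle (2 * π) × AddCircle (2 * π) => q + (a, a))
      volume volume := measurePreserving_add_right volume (a, a)
  have h3 := h2.comp (h1.prod h1)
  have hc : Continuous fun q : AddCircle (2 * π) × AddCircle (2 * π) => anglesPlane (t, q) :=
    continuous_anglesPlane.comp (continuous_const.prodMk continuous_id)
  rw [← h3.map_eq, Measure.map_map hc.measurable h3.measurable]
  congr 1
  funext x
  have e : ∀ y : ℝ, hopfPhase (hopfParam t) * Circle.exp (y - π / 2) =
      AddCircle.toCircle ((y : AddCircle (2 * π)) + a) := by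
    intro y
    have e1 : (y : AddCircle (2 * π)) + a = ((t + (y - π / 2) : ℝ) : AddCircle (2 * π)) := by
      simp only [a]
      rw [← AddCircle.coe_add]
      congr 1
      ring
    rw [e1, hopfPhase_hopfParam, AddCircle.coe_add, AddCircle.toCircle_add]
    congr 1
    rw [AddCircle.toCircle_apply_mk, div_self (by positivity), one_mul]
  rw [fiberPlane_eq_framePlane, e, e, hopfPhase_hopfParam]
  rfl

theorem measurable_uniformPlanes : Measurable uniformPlanes := by
  have hc : Continuous fun y : hopfFiber × (ℝ × ℝ) => fiberPlane y.1 y.2 := by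
    simp only [fiberPlane_eq_framePlane]
    have h := continuous_hopfPhase
    exact continuous_framePlane.comp (by fun_prop)
  refine Measure.measurable_of_measurable_coe _ fun B hB => ?_
  have hp : ∀ p : hopfFiber, Continuous (fiberPlane p) := fun p =>
    hc.comp (continuous_const.prodMk continuous_id)
  have e : (fun p => uniformPlanes p B) = fun p => (ENNReal.ofReal ((2 * π) ^ 2)⁻¹ •
      (volume : Measure (ℝ × ℝ)).restrict (Ico 0 (2 * π) ×ˢ Ico 0 (2 * π)))
        (Prod.mk p ⁻¹' ((fun y : hopfFiber × (ℝ × ℝ) => fiberPlane y.1 y.2) ⁻¹' B)) := by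
    funext p
    rw [uniformPlanes, Measure.map_apply (hp p).measurable hB]
    rfl
  rw [e]
  have : SFinite (ENNReal.ofReal ((2 * π) ^ 2)⁻¹ •
      (volume : Measure (ℝ × ℝ)).restrict (Ico 0 (2 * π) ×ˢ Ico 0 (2 * π))) := inferInstance
  exact measurable_measure_prodMk_left (hc.measurable hB)

theorem limitVarifold_eq_map : limitVarifold =
    ENNReal.ofReal (2 * π)⁻¹ • Measure.map anglesPlane volume := by
  ext B hB
  have hBm : MeasurableSet (anglesPlane ⁻¹' B) := continuous_anglesPlane.measurable hB
  have h1 := AddCircle.measurePreserving_mk (2 * π) 0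
  rw [zero_add] at h1
  have hc : ∀ t : AddCircle (2 * π), Measurable
      fun q : AddCircle (2 * π) × AddCircle (2 * π) => anglesPlane (t, q) := fun t =>
    (continuous_anglesPlane.comp (continuous_const.prodMk continuous_id)).measurable
  have key : ∫⁻ t in Ioc 0 (2 * π), uniformPlanes (hopfParam t) B =
      ENNReal.ofReal ((2 * π) ^ 2)⁻¹ * volume (anglesPlane ⁻¹' B) := by
    have e1 : ∀ t : ℝ, uniformPlanes (hopfParam t) B = ENNReal.ofReal ((2 * π) ^ 2)⁻¹ *
        volume (Prod.mk (t : AddCircle (2 * π)) ⁻¹' (anglesPlane ⁻¹' B)) := by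
      intro t
      rw [uniformPlanes_hopfParam, Measure.smul_apply, Measure.map_apply (hc t) hB]
      rfl
    have hm := measurable_measure_prodMk_left
      (ν := (volume : Measure (AddCircle (2 * π) × AddCircle (2 * π)))) hBm
    simp only [e1]
    refine (lintegral_const_mul _ (hm.comp h1.measurable)).trans ?_
    congr 1
    exact (h1.lintegral_comp hm).trans (Measure.prod_apply hBm).symm
  rw [limitVarifold, Measure.smul_apply, Measure.bind_apply hB measurable_uniformPlanes.aemeasurable,
    hausdorffMeasure_hopfFiber, lintegral_map (Measure.measurable_measure.1 measurable_uniformPlanes B hB)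
      lipschitzWith_hopfParam.continuous.measurable, key, Measure.smul_apply,
    Measure.map_apply continuous_anglesPlane.measurable hB, smul_eq_mul, smul_eq_mul, ← mul_assoc,
    ← ENNReal.ofReal_mul (by positivity)]
  congr 2
  field_simp

/-! ### Equidistribution of the phases -/

/-- Translate `s` by `y/(2n)`, then `θ` by `-n(s + y/(2n))`. The left side is free of `y`, while on
the right `y` moves the second phase fully and the third only by `y/(2n)`. -/
theorem integral_phases_eq (f : AddCircle (2 * π) → AddCircle (2 * π) → AddCircle (2 * π) → ℝ)
    {n : ℕ} (hn : n ≠ 0) (y : ℝ) :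
    ∫ s, ∫ θ, f (θ + n • s) (-θ + n • s) (-s) =
      ∫ s : AddCircle (2 * π), ∫ θ, f θ (-θ + (2 * n) • s + y)
        (-s - ((y / (2 * n) : ℝ) : AddCircle (2 * π))) := by
  rw [← integral_add_right_eq_self _ ((y / (2 * n) : ℝ) : AddCircle (2 * π))]
  congr 1
  funext s
  have hy : n • ((y / (2 * n) : ℝ) : AddCircle (2 * π)) = ((y / 2 : ℝ) : AddCircle (2 * π)) := by
    rw [← AddCircle.coe_nsmul, nsmul_eq_mul]
    congr 1
    field_simp
  rw [← integral_sub_right_eq_self _ (n • (s + ((y / (2 * n) : ℝ) : AddCircle (2 * π))))]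
  congr 1
  funext θ
  have hyy : (y : AddCircle (2 * π)) = ((y / 2 : ℝ) : AddCircle (2 * π)) +
      ((y / 2 : ℝ) : AddCircle (2 * π)) := by
    rw [← AddCircle.coe_add, add_halves]
  congr 1
  · abel
  · rw [nsmul_add, hy, hyy, mul_nsmul, two_nsmul]
    simp only [nsmul_add]
    abel
  · abel

/-- Compactness makes the two errors, in `β` and in the shift of the third phase, uniform. -/
theorem eventually_forall_dist_lt
    {G : ℝ × AddCircle (2 * π) × AddCircle (2 * π) × AddCircle (2 * π) → ℝ} (hG : Continuous G)
    {ε : ℝ} (hε : 0 < ε) : ∀ᶠ d : ℝ × ℝ in 𝓝 (0, 0),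
      ∀ x ∈ (univ : Set (AddCircle (2 * π) × AddCircle (2 * π) × AddCircle (2 * π))),
        |G (d.1, x.1, x.2.1, x.2.2 - (d.2 : AddCircle (2 * π))) - G (0, x)| < ε := by
  refine isCompact_univ.eventually_forall_of_forall_eventually fun x _ => ?_
  have hc : Continuous fun z : (ℝ × ℝ) × AddCircle (2 * π) × AddCircle (2 * π) × AddCircle (2 * π) =>
      |G (z.1.1, z.2.1, z.2.2.1, z.2.2.2 - (z.1.2 : AddCircle (2 * π))) - G (0, z.2)| := by
    have := AddCircle.continuous_mk' (2 * π)
    refine ((hG.comp ?_).sub (hG.comp ?_)).abs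
    · refine (continuous_fst.comp continuous_fst).prodMk
        ((continuous_fst.comp continuous_snd).prodMk
          ((continuous_fst.comp (continuous_snd.comp continuous_snd)).prodMk
            ((continuous_snd.comp (continuous_snd.comp continuous_snd)).sub
              (this.comp (continuous_snd.comp continuous_fst)))))
    · exact continuous_const.prodMk continuous_snd
  have h0 := hc.tendsto ((0, 0), x)
  refine h0.eventually (gt_mem_nhds ?_)
  simpa using hε

/-- Averaging `integral_phases_eq` over `y` gives equidistribution without Fourier series: the
second phase averages out exactly, and the shift `y/(2n)` tends to zero uniformly. -/
theorem tendsto_integral_phases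
    {G : ℝ × AddCircle (2 * π) × AddCircle (2 * π) × AddCircle (2 * π) → ℝ} (hG : Continuous G)
    {β : ℕ → ℝ} (hβ : Tendsto β atTop (𝓝 0)) {n : ℕ → ℕ} (hn : Tendsto n atTop atTop) :
    Tendsto (fun k => ∫ s, ∫ θ, G (β k, θ + n k • s, -θ + n k • s, -s)) atTop
      (𝓝 ((2 * π)⁻¹ * ∫ p : AddCircle (2 * π) × AddCircle (2 * π), ∫ η, G (0, p.2, η, -p.1))) := by
  let T := AddCircle (2 * π)
  have hmk : Continuous fun y : ℝ => (y : AddCircle (2 * π)) := AddCircle.continuous_mk' (2 * π)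
  let m : Measure (ℝ × (T × T)) := (volume.restrict (Ioc 0 (2 * π))).prod volume
  have hb : ∀ b : ℝ, ∃ C, ∀ x, ‖G (b, x)‖ ≤ C := fun b => by
    obtain ⟨C, hC⟩ := isCompact_univ.exists_bound_of_continuousOn
      (hG.comp (continuous_const.prodMk continuous_id : Continuous fun x => (b, x))).continuousOn
    exact ⟨C, fun x => hC x trivial⟩
  -- `K` is the exact integrand with the auxiliary `y` as first variable; `L` drops the error in `β`
  -- and the shift of the third phase.
  let K : ℕ → ℝ × (T × T) → ℝ := fun k z => G (β k, z.2.2, -z.2.2 + (2 * n k) • z.2.1 + (z.1 : T),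
    -z.2.1 - ((z.1 / (2 * n k) : ℝ) : T))
  let L : ℕ → ℝ × (T × T) → ℝ := fun k z => G (0, z.2.2, -z.2.2 + (2 * n k) • z.2.1 + (z.1 : T),
    -z.2.1)
  have hmid : ∀ k, Continuous fun z : ℝ × (T × T) => -z.2.2 + (2 * n k) • z.2.1 + (z.1 : T) :=
    fun k => ((continuous_snd.comp continuous_snd).neg.add
      ((continuous_fst.comp continuous_snd).nsmul _)).add (hmk.comp continuous_fst)
  have hKc : ∀ k, Continuous (K k) := fun k => hG.comp (continuous_const.prodMk
    ((continuous_snd.comp continuous_snd).prodMk ((hmid k).prodMk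
      ((continuous_fst.comp continuous_snd).neg.sub
        (hmk.comp (continuous_fst.div_const _))))))
  have hLc : ∀ k, Continuous (L k) := fun k => hG.comp (continuous_const.prodMk
    ((continuous_snd.comp continuous_snd).prodMk ((hmid k).prodMk
      ((continuous_fst.comp continuous_snd).neg))))
  have hKi : ∀ k, Integrable (K k) m := fun k => by
    obtain ⟨C, hC⟩ := hb (β k)
    exact Integrable.of_bound (hKc k).aestronglyMeasurable C (Eventually.of_forall fun z => hC _)
  have hLi : ∀ k, Integrable (L k) m := fun k => by
    obtain ⟨C, hC⟩ := hb 0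
    exact Integrable.of_bound (hLc k).aestronglyMeasurable C (Eventually.of_forall fun z => hC _)
  have hKint : ∀ k, n k ≠ 0 → ∫ z, K k z ∂m =
      2 * π * ∫ s, ∫ θ, G (β k, θ + n k • s, -θ + n k • s, -s) := by
    intro k hk
    rw [integral_prod _ (hKi k)]
    have e : ∀ y : ℝ, ∫ p : T × T, K k (y, p) =
        ∫ s, ∫ θ, G (β k, θ + n k • s, -θ + n k • s, -s) := by
      intro y
      rw [integral_phases_eq (fun a b c => G (β k, a, b, c)) hk y]
      refine integral_prod (fun p : T × T => K k (y, p)) ?_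
      obtain ⟨C, hC⟩ := hb (β k)
      exact Integrable.of_bound
        ((hKc k).comp (continuous_const.prodMk continuous_id)).aestronglyMeasurable C
        (Eventually.of_forall fun z => hC _)
    simp only [e]
    rw [integral_const]
    simp [Real.two_pi_pos.le]
  -- Integrating in `y` first, the fast phase is a mere translation, so the value is the same for
  -- every `k`.
  have hLint : ∀ k, ∫ z, L k z ∂m = ∫ p : T × T, ∫ η, G (0, p.2, η, -p.1) := by
    intro k
    rw [integral_prod_symm _ (hLi k)]
    congr 1
    funext p
    have h1 := AddCircle.integral_preimage (2 * π) 0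
      (fun y => G (0, p.2, -p.2 + (2 * n k) • p.1 + y, -p.1))
    rw [zero_add] at h1
    refine h1.trans ?_
    exact integral_add_left_eq_self (fun y => G (0, p.2, y, -p.1)) _
  have hmfin : m.real univ = (2 * π) ^ 3 := by
    simp only [m, Measure.real]
    rw [← univ_prod_univ, Measure.prod_prod, ← univ_prod_univ, 
      show (volume : Measure (T × T)) = volume.prod volume from rfl, Measure.prod_prod]
    simp [T, AddCircle.measure_univ, ENNReal.toReal_ofReal Real.pi_pos.le]
    ring
  have hdiff : Tendsto (fun k => ∫ z, K k z ∂m - ∫ z, L k z ∂m) atTop (𝓝 0) := by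
    rw [Metric.tendsto_nhds]
    intro ε hε
    -- The total mass of `m` is `(2π)³`, so this pointwise bound integrates to `ε / 2`.
    have hε' : 0 < ε / (2 * (2 * π) ^ 3) := by positivity
    obtain ⟨A, hA, D, hD, hAD⟩ := mem_nhds_prod_iff.1 (eventually_forall_dist_lt hG hε')
    obtain ⟨r, hr, hrD⟩ := Metric.mem_nhds_iff.1 hD
    have hn' : Tendsto (fun k => 2 * π / (2 * (n k : ℝ))) atTop (𝓝 0) := by
      refine tendsto_const_nhds.div_atTop ?_
      exact (tendsto_natCast_atTop_atTop.comp hn).const_mul_atTop two_pos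
    filter_upwards [hβ.eventually hA, hn'.eventually (gt_mem_nhds hr), hn.eventually_ge_atTop 1]
      with k hk1 hk2 hk3
    rw [dist_zero_right, ← integral_sub (hKi k) (hLi k)]
    have hnk : (1 : ℝ) ≤ n k := by exact_mod_cast hk3
    have hbound : ∀ᵐ z ∂m, ‖K k z - L k z‖ ≤ ε / (2 * (2 * π) ^ 3) := by
      have hae : ∀ᵐ z ∂m, z.1 ∈ Ioc 0 (2 * π) :=
        Measure.quasiMeasurePreserving_fst.ae (ae_restrict_mem measurableSet_Ioc)
      filter_upwards [hae] with z hz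
      have hd : z.1 / (2 * n k) ∈ D := by
        apply hrD
        rw [Metric.mem_ball, dist_zero_right, Real.norm_of_nonneg (by have := hz.1; positivity)]
        refine lt_of_le_of_lt ?_ hk2
        have := hz.2
        gcongr
      exact (hAD (mk_mem_prod hk1 hd)
        (z.2.2, -z.2.2 + (2 * n k) • z.2.1 + (z.1 : T), -z.2.1) trivial).le
    refine (norm_integral_le_of_norm_le_const hbound).trans_lt ?_
    rw [hmfin]
    have : ε / (2 * (2 * π) ^ 3) * (2 * π) ^ 3 = ε / 2 := by field_simp
    rw [this]
    linarith
  have hfin : Tendsto (fun k => (2 * π)⁻¹ * ∫ z, K k z ∂m) atTop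
      (𝓝 ((2 * π)⁻¹ * ∫ p : T × T, ∫ η, G (0, p.2, η, -p.1))) := by
    refine Tendsto.const_mul _ ?_
    have := hdiff.add_const (∫ p : T × T, ∫ η, G (0, p.2, η, -p.1))
    simpa [hLint] using this
  refine hfin.congr' ?_
  filter_upwards [hn.eventually_ge_atTop 1] with k hk
  rw [hKint k (by omega), ← mul_assoc, inv_mul_cancel₀ (by positivity), one_mul]

/-! ### Integrals against the torus varifolds -/

theorem integral_toCircle {R : ℝ} (hR : 0 < R) (f : Circle → ℝ) [Fact (0 < 2 * π * R)] :
    ∫ φ : AddCircle (2 * π * R), f φ.toCircle = R * ∫ s : AddCircle (2 * π), f s.toCircle := by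
  rw [← AddCircle.intervalIntegral_preimage (2 * π * R) 0,
    ← AddCircle.intervalIntegral_preimage (2 * π) 0]
  have h := intervalIntegral.mul_integral_comp_mul_left
    (f := fun φ : ℝ => f (AddCircle.toCircle (φ : AddCircle (2 * π * R)))) (a := 0) (b := 2 * π) (c := R)
  rw [mul_zero, mul_comm R (2 * π)] at h
  rw [zero_add, zero_add, ← h]
  congr 2
  funext s
  rw [AddCircle.toCircle_apply_mk, AddCircle.toCircle_apply_mk]
  congr 2
  field_simp

/-- Rescaling the long circle costs a factor `R`, which meets the area density `sin²β` in `R sin²β =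
cos β`: the mass stays bounded away from zero as `R` grows. -/
theorem integral_torusVarifold {n : ℕ} {β R : ℝ} (h : IsConformalParam n β R) {Φ : LegGr → ℝ}
    (hΦ : Continuous Φ) : ∫ g, Φ g ∂(torusVarifold n β R) =
      cos β * ∫ s : AddCircle (2 * π), ∫ θ : AddCircle (2 * π),
        Φ (framePlane (β, (θ + n • s).toCircle, (-θ + n • s).toCircle, (-s).toCircle)) := by
  have := fact_pos_mul h.pos
  rw [torusVarifold, integral_map continuous_framePlane_phases.measurable.aemeasurable
      hΦ.measurable.aestronglyMeasurable, integral_smul_measure, torus_area_eq_volume]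
  have hc : Continuous fun x : Torus R => Φ (framePlane (β, phases n x)) :=
    hΦ.comp continuous_framePlane_phases
  obtain ⟨C, hC⟩ := isCompact_univ.exists_bound_of_continuousOn hc.continuousOn
  have hi : Integrable (fun x : Torus R => Φ (framePlane (β, phases n x))) volume :=
    Integrable.of_bound hc.aestronglyMeasurable C (Eventually.of_forall fun x => hC x trivial)
  have e : ∫ x : Torus R, Φ (framePlane (β, phases n x)) =
      ∫ φ : AddCircle (2 * π * R), ∫ θ : AddCircle (2 * π), Φ (framePlane (β, phases n (θ, φ))) :=
    integral_prod_symm _ hi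
  have e2 := integral_toCircle h.pos (fun w => ∫ θ : AddCircle (2 * π),
    Φ (framePlane (β, θ.toCircle * w ^ n, θ.toCircle⁻¹ * w ^ n, w⁻¹)))
  rw [e]
  simp only [phases]
  rw [e2, ENNReal.toReal_ofReal (sq_nonneg _), smul_eq_mul, ← mul_assoc, mul_comm _ R, h.length]
  have hnsmul : ∀ s : AddCircle (2 * π), (n • s).toCircle = s.toCircle ^ n :=
    fun s => AddCircle.toCircle_nsmul s n
  simp only [AddCircle.toCircle_add, AddCircle.toCircle_neg, hnsmul]

/-! ### Rectifiable varifolds do not charge the Hopf fiber -/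

/-- A zero with nonzero derivative is isolated among the zeros, and a set of reals has only
countably many points isolated from the right. -/
theorem countable_setOf_zero_deriv_ne_zero {f f' : ℝ → ℝ} (hf : ∀ y, HasDerivAt f (f' y) y) :
    {y | f y = 0 ∧ f' y ≠ 0}.Countable := by
  let s : Set ℝ := {y | f y = 0 ∧ f' y ≠ 0}
  refine (countable_setOfPred_isolated_right_within (s := s)).mono fun y hy =>
    show y ∈ s ∧ 𝓝[s ∩ Ioi y] y = ⊥ from ⟨hy, ?_⟩
  have h1 : ∀ᶠ z in 𝓝[s ∩ Ioi y] y, f z ≠ 0 :=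
    ((hf y).eventually_ne hy.2).filter_mono (nhdsWithin_mono _ fun z hz => ne_of_gt hz.2)
  refine eventually_false_iff_eq_bot.1 ?_
  filter_upwards [h1, self_mem_nhdsWithin] with z hz hz'
  exact hz hz'.1.1

/-- By Fubini, since each vertical slice is countable. -/
theorem volume_setOf_zero_partial_ne_zero {ρ : ℝ × ℝ → ℝ} (hρ : ContDiff ℝ 1 ρ) :
    volume {z | ρ z = 0 ∧ fderiv ℝ ρ z (0, 1) ≠ 0} = 0 := by
  have hc : Continuous fun z => fderiv ℝ ρ z (0, 1) :=
    (hρ.continuous_fderiv one_ne_zero).clm_apply continuous_const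
  have hm : MeasurableSet {z | ρ z = 0 ∧ fderiv ℝ ρ z (0, 1) ≠ 0} :=
    (isClosed_eq hρ.continuous continuous_const).measurableSet.inter
      (isOpen_ne_fun hc continuous_const).measurableSet
  rw [Measure.volume_eq_prod, Measure.measure_prod_null hm]
  refine Eventually.of_forall fun x => ?_
  refine Set.Countable.measure_zero ?_ _
  refine countable_setOf_zero_deriv_ne_zero (f := fun y => ρ (x, y))
    (f' := fun y => fderiv ℝ ρ (x, y) (0, 1)) fun y => ?_
  exact ((hρ.differentiable one_ne_zero) (x, y)).hasFDerivAt.comp_hasDerivAt y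
    ((hasDerivAt_const y x).prodMk (hasDerivAt_id y))

theorem volume_setOf_zero_fderiv_ne_zero {ρ : ℝ × ℝ → ℝ} (hρ : ContDiff ℝ 1 ρ) :
    volume {z | ρ z = 0 ∧ fderiv ℝ ρ z ≠ 0} = 0 := by
  have h1 := volume_setOf_zero_partial_ne_zero hρ
  have h2 := volume_setOf_zero_partial_ne_zero (ρ := ρ ∘ Prod.swap) (hρ.comp
    (contDiff_snd.prodMk contDiff_fst))
  have hswap : ∀ z, fderiv ℝ (ρ ∘ Prod.swap) z (0, 1) = fderiv ℝ ρ z.swap (1, 0) := by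
    intro z
    have e : HasFDerivAt (Prod.swap : ℝ × ℝ → ℝ × ℝ)
        ((ContinuousLinearMap.snd ℝ ℝ ℝ).prod (ContinuousLinearMap.fst ℝ ℝ ℝ)) z :=
      hasFDerivAt_snd.prodMk hasFDerivAt_fst
    have := (((hρ.differentiable one_ne_zero) z.swap).hasFDerivAt.comp z e).fderiv
    rw [this]
    simp
  have hmp : MeasurePreserving (Prod.swap : ℝ × ℝ → ℝ × ℝ) volume volume :=
    Measure.measurePreserving_swap
  have h3 : volume (Prod.swap ⁻¹' {z : ℝ × ℝ | ρ z = 0 ∧ fderiv ℝ ρ z (1, 0) ≠ 0}) = 0 := by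
    simpa only [hswap, Function.comp_apply, preimage_ofPred_eq] using h2
  have hemb : MeasurableEmbedding (Prod.swap : ℝ × ℝ → ℝ × ℝ) :=
    MeasurableEquiv.prodComm.measurableEmbedding
  rw [hmp.measure_preimage_emb hemb] at h3
  refine measure_mono_null (fun z hz => ?_) (measure_union_null h1 h3)
  by_contra hn
  simp only [mem_union, mem_ofPred_eq, not_or, not_and, not_not] at hn
  refine hz.2 ?_
  ext
  · simpa using hn.2 hz.1
  · simpa using hn.1 hz.1

/-- The vectors `p` and `ip` form a real basis of the third coordinate line, and `w` is orthogonal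
to both: the fiber is transverse to the contact planes. -/
theorem eq_zero_of_hopfFiber {p w : E} (hp : p ∈ hopfFiber) (h0 : w 0 = 0) (h1 : w 1 = 0)
    (hpw : inner ℝ p w = 0) (hIpw : contactForm p w = 0) : w = 0 := by
  obtain ⟨hp0, hp1, hp2⟩ := hp
  rw [inner_eq, hp0, hp1, h0, h1] at hpw
  rw [contactForm, inner_eq] at hIpw
  simp only [PiLp.smul_apply, hp0, hp1, h0, h1, smul_eq_mul, Complex.I_mul_re, Complex.I_mul_im,
    Complex.zero_re, Complex.zero_im] at hpw hIpw
  have hn : (p 2).re ^ 2 + (p 2).im ^ 2 = 1 := by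
    have := Complex.sq_norm (p 2)
    rw [hp2, Complex.normSq_apply] at this
    linarith
  have hre : (w 2).re = 0 := by
    linear_combination -(w 2).re * hn + (p 2).re * hpw - (p 2).im * hIpw
  have him : (w 2).im = 0 := by
    linear_combination -(w 2).im * hn + (p 2).im * hpw + (p 2).re * hIpw
  ext i
  fin_cases i
  exacts [h0, h1, Complex.ext hre him]

/-- At almost every such point the derivatives of the first two complex coordinates vanish along
with the coordinates. The tangent plane then lies in the third coordinate line, where horizontality
reduces it to zero, against rank two. -/
theorem volume_preimage_hopfFiber {A : Set (ℝ × ℝ)} {g : ℝ × ℝ → E} (hg : ContDiff ℝ 1 g)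
    (hA : ∀ z ∈ A, IsLegendrianPlane (g z) (LinearMap.range (fderiv ℝ g z).toLinearMap)) :
    volume {z ∈ A | g z ∈ hopfFiber} = 0 := by
  let re : Fin 3 → E →L[ℝ] ℝ := fun j =>
    Complex.reCLM ∘L (PiLp.proj 2 (fun _ : Fin 3 => ℂ) j : E →L[ℝ] ℂ)
  let im : Fin 3 → E →L[ℝ] ℝ := fun j =>
    Complex.imCLM ∘L (PiLp.proj 2 (fun _ : Fin 3 => ℂ) j : E →L[ℝ] ℂ)
  have hnull : ∀ l : E →L[ℝ] ℝ, volume {z | l (g z) = 0 ∧ l ∘L fderiv ℝ g z ≠ 0} = 0 := by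
    intro l
    have h := volume_setOf_zero_fderiv_ne_zero (l.contDiff.comp hg)
    have e : ∀ z, fderiv ℝ (l ∘ g) z = l ∘L fderiv ℝ g z := fun z =>
      (l.hasFDerivAt.comp z ((hg.differentiable one_ne_zero) z).hasFDerivAt).fderiv
    simpa only [e, Function.comp_apply] using h
  refine measure_mono_null (fun z hz => ?_) (measure_union_null
    (measure_union_null (hnull (re 0)) (hnull (im 0)))
    (measure_union_null (hnull (re 1)) (hnull (im 1))))
  obtain ⟨hzA, hzC⟩ := hz
  obtain ⟨h0, h1, -⟩ := id hzC
  obtain ⟨hrank, hleg, -⟩ := hA z hzA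
  by_contra hn
  simp only [mem_union, mem_ofPred_eq, not_or, not_and, not_not] at hn
  obtain ⟨⟨a0, b0⟩, a1, b1⟩ := hn
  have a0' := a0 (by simp [re, h0])
  have b0' := b0 (by simp [im, h0])
  have a1' := a1 (by simp [re, h1])
  have b1' := b1 (by simp [im, h1])
  have hbot : LinearMap.range (fderiv ℝ g z).toLinearMap = ⊥ := by
    rw [eq_bot_iff]
    rintro w ⟨v, rfl⟩
    obtain ⟨e1, e2⟩ := hleg _ ⟨v, rfl⟩
    refine eq_zero_of_hopfFiber hzC (Complex.ext ?_ ?_) (Complex.ext ?_ ?_) e1 e2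
    · simpa [re] using DFunLike.congr_fun a0' v
    · simpa [im] using DFunLike.congr_fun b0' v
    · simpa [re] using DFunLike.congr_fun a1' v
    · simpa [im] using DFunLike.congr_fun b1' v
  rw [hbot, finrank_bot] at hrank
  omega

theorem isClosed_hopfFiber : IsClosed hopfFiber := by
  have h : ∀ j : Fin 3, Continuous fun p : E => p j := fun j => PiLp.continuous_apply 2 _ j
  exact (isClosed_eq (h 0) continuous_const).inter
    ((isClosed_eq (h 1) continuous_const).inter (isClosed_eq (h 2).norm continuous_const))

theorem continuous_pt : Continuous LegGr.pt :=
  continuous_fst.comp (continuous_induced_dom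
    (f := fun g : LegGr => ((g.pt, g.plane.starProjection) : E × (E →L[ℝ] E))))

theorem IsRectifiableVarifold.measure_hopfFiber {v : Measure LegGr}
    (hv : IsRectifiableVarifold v) : v (LegGr.pt ⁻¹' hopfFiber) = 0 := by
  obtain ⟨c, A, g, hAg, hB⟩ := hv
  rw [hB _ (isClosed_hopfFiber.preimage continuous_pt).measurableSet, ENNReal.tsum_eq_zero]
  intro i
  obtain ⟨-, hg, -, hA⟩ := hAg i
  have h0 := volume_preimage_hopfFiber hg fun z hz => (hA z hz).2
  refine mul_eq_zero_of_right _ (setLIntegral_measure_zero _ _ (measure_mono_null ?_ h0))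
  rintro z ⟨hz, b, hb, hbz, -⟩
  refine ⟨hz, ?_⟩
  rw [← hbz]
  exact hb

/-! ### The sequence of tori -/

/-- The angle with `sin² β = 1 / (k + 2)`. -/
def seqAngle (k : ℕ) : ℝ := Real.arcsin (√(k + 2))⁻¹

/-- The lengths of the tori. -/
def seqLength (k : ℕ) : ℝ := cos (seqAngle k) / sin (seqAngle k) ^ 2

theorem sin_seqAngle (k : ℕ) : sin (seqAngle k) = (√(k + 2))⁻¹ := by
  have h : (1 : ℝ) ≤ √(k + 2) := Real.one_le_sqrt.2 (by linarith [Nat.cast_nonneg (α := ℝ) k])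
  have hpos : 0 ≤ (√((k : ℝ) + 2))⁻¹ := by positivity
  exact Real.sin_arcsin (by linarith) (inv_le_one_of_one_le₀ h)

theorem sin_sq_seqAngle (k : ℕ) : sin (seqAngle k) ^ 2 = ((k : ℝ) + 2)⁻¹ := by
  rw [sin_seqAngle, inv_pow, Real.sq_sqrt (by positivity)]

theorem cos_seqAngle_pos (k : ℕ) : 0 < cos (seqAngle k) := by
  rw [seqAngle, Real.cos_arcsin, ← sin_seqAngle, sin_sq_seqAngle]
  refine Real.sqrt_pos.2 (sub_pos.2 (inv_lt_one_of_one_lt₀ ?_))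
  linarith [Nat.cast_nonneg (α := ℝ) k]

/-- The relation `freq` forces `sin²β = 1/(n + 1)`. The frequency starts at `n = 1` because `n = 0`
would give `cos β = 0`. -/
theorem isConformalParam_seq (k : ℕ) : IsConformalParam (k + 1) (seqAngle k) (seqLength k) where
  sin_pos := by rw [sin_seqAngle]; positivity
  cos_pos := cos_seqAngle_pos k
  pos := by
    have h := cos_seqAngle_pos k
    rw [seqLength, sin_sq_seqAngle]
    positivity
  freq := by
    rw [cos_sq', sin_sq_seqAngle]
    push_cast
    field_simp
    ring
  length := by
    rw [seqLength, sin_sq_seqAngle]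
    field_simp

theorem tendsto_seqAngle : Tendsto seqAngle atTop (𝓝 0) := by
  have h : Tendsto (fun k : ℕ => (√((k : ℝ) + 2))⁻¹) atTop (𝓝 0) :=
    tendsto_inv_atTop_zero.comp (Real.tendsto_sqrt_atTop.comp
      (tendsto_atTop_add_const_right _ _ tendsto_natCast_atTop_atTop))
  have h2 := (Real.continuous_arcsin.tendsto 0).comp h
  rwa [Real.arcsin_zero] at h2

/-- Here `R = cos β/sin²β ≥ cos²β/sin²β = k + 1`. -/
theorem tendsto_seqLength : Tendsto seqLength atTop atTop := by
  refine tendsto_atTop_mono (fun k => ?_) tendsto_natCast_atTop_atTop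
  have h := isConformalParam_seq k
  have hs := h.sin_pos
  have hc := h.cos_pos
  rw [seqLength, le_div_iff₀ (by positivity)]
  have h1 := h.freq
  push_cast at h1
  have h2 : cos (seqAngle k) ^ 2 ≤ cos (seqAngle k) := by
    nlinarith [Real.cos_le_one (seqAngle k)]
  nlinarith [sq_nonneg (sin (seqAngle k))]

/-- The varifolds of the sequence of tori. -/
def seqVarifold (k : ℕ) : Measure LegGr := torusVarifold (k + 1) (seqAngle k) (seqLength k)

/-! ### Passage to the limit -/

theorem integral_limitVarifold {Φ : LegGr → ℝ} (hΦ : Continuous Φ) :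
    ∫ g, Φ g ∂limitVarifold = (2 * π)⁻¹ * ∫ p : AddCircle (2 * π) × AddCircle (2 * π),
      ∫ η : AddCircle (2 * π),
        Φ (framePlane (0, p.2.toCircle, η.toCircle, (-p.1).toCircle)) := by
  have hc : Continuous fun q => Φ (anglesPlane q) := hΦ.comp continuous_anglesPlane
  have hint : ∀ {X : Type} [TopologicalSpace X] [CompactSpace X] [SecondCountableTopology X]
      [MeasurableSpace X] [OpensMeasurableSpace X] (μ : Measure X) [IsFiniteMeasure μ]
      (f : X → ℝ), Continuous f → Integrable f μ := by
    intro X _ _ _ _ _ μ _ f hf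
    obtain ⟨C, hC⟩ := isCompact_univ.exists_bound_of_continuousOn hf.continuousOn
    exact Integrable.of_bound hf.aestronglyMeasurable C (Eventually.of_forall fun x => hC x trivial)
  rw [limitVarifold_eq_map, integral_smul_measure,
    integral_map continuous_anglesPlane.measurable.aemeasurable hΦ.measurable.aestronglyMeasurable,
    ENNReal.toReal_ofReal (by positivity), smul_eq_mul]
  congr 1
  have e1 : ∫ q, Φ (anglesPlane q) = ∫ s : AddCircle (2 * π), ∫ θ : AddCircle (2 * π),
      ∫ η : AddCircle (2 * π), Φ (anglesPlane (s, θ, η)) := by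
    refine (integral_prod _ (hint _ _ hc)).trans (integral_congr_ae (Eventually.of_forall ?_))
    intro s
    exact integral_prod (fun p : AddCircle (2 * π) × AddCircle (2 * π) => Φ (anglesPlane (s, p)))
      (hint _ _ (hc.comp (continuous_const.prodMk continuous_id)))
  -- The reflection matches the third phase `-s` of the tori.
  rw [e1, ← integral_neg_eq_self]
  refine (integral_prod (fun p : AddCircle (2 * π) × AddCircle (2 * π) => ∫ η : AddCircle (2 * π),
    Φ (framePlane (0, p.2.toCircle, η.toCircle, (-p.1).toCircle))) ?_).symm
  refine Integrable.integral_prod_left (f := fun z : (AddCircle (2 * π) × AddCircle (2 * π)) ×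
    AddCircle (2 * π) => Φ (anglesPlane (-z.1.1, z.1.2, z.2))) (hint _ _ ?_)
  exact hc.comp ((continuous_fst.comp continuous_fst).neg.prodMk
    ((continuous_snd.comp continuous_fst).prodMk continuous_snd))

theorem varifoldTendsto_seqVarifold : VarifoldTendsto seqVarifold limitVarifold := by
  intro Φ hΦ
  have hcirc := AddCircle.continuous_toCircle (T := 2 * π)
  have hG : Continuous fun x : ℝ × AddCircle (2 * π) × AddCircle (2 * π) × AddCircle (2 * π) =>
      Φ (framePlane (x.1, x.2.1.toCircle, x.2.2.1.toCircle, x.2.2.2.toCircle)) := by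
    refine hΦ.comp (continuous_framePlane.comp ?_)
    exact continuous_fst.prodMk ((hcirc.comp (continuous_fst.comp continuous_snd)).prodMk
      ((hcirc.comp (continuous_fst.comp (continuous_snd.comp continuous_snd))).prodMk
        (hcirc.comp (continuous_snd.comp (continuous_snd.comp continuous_snd)))))
  have h := tendsto_integral_phases hG tendsto_seqAngle (tendsto_add_atTop_nat 1)
  have hcos : Tendsto (fun k => cos (seqAngle k)) atTop (𝓝 1) := by
    have := (Real.continuous_cos.tendsto 0).comp tendsto_seqAngle
    rwa [Real.cos_zero] at this
  have h2 := hcos.mul h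
  rw [one_mul] at h2
  rw [integral_limitVarifold hΦ]
  refine h2.congr fun k => ?_
  exact (integral_torusVarifold (isConformalParam_seq k) hΦ).symm

theorem isFiniteMeasure_limitVarifold : IsFiniteMeasure limitVarifold := by
  rw [limitVarifold_eq_map]
  exact Measure.smul_finite _ ENNReal.ofReal_ne_top

theorem isHSLV_limitVarifold : IsHSLV limitVarifold := by
  refine ⟨isFiniteMeasure_limitVarifold, fun F hF => ?_⟩
  have h := varifoldTendsto_seqVarifold _ (continuous_divPlane (continuous_fderiv_hamField hF))
  have h0 : ∀ k, ∫ g, divPlane (hamField F) g.plane g.pt ∂(seqVarifold k) = 0 := fun k =>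
    (isHSLV_torusVarifold (isConformalParam_seq k)).2 F hF
  simp only [h0] at h
  exact tendsto_nhds_unique h tendsto_const_nhds

theorem not_isRectifiableVarifold_limitVarifold : ¬ IsRectifiableVarifold limitVarifold := by
  intro h
  have h0 := h.measure_hopfFiber
  have hm : MeasurableSet (LegGr.pt ⁻¹' hopfFiber) :=
    (isClosed_hopfFiber.preimage continuous_pt).measurableSet
  have huniv : anglesPlane ⁻¹' (LegGr.pt ⁻¹' hopfFiber) = univ := by
    refine eq_univ_of_forall fun q => ?_
    refine ⟨?_, ?_, ?_⟩ <;> simp [anglesPlane, framePlane, framePt, Circle.norm_coe]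
  rw [limitVarifold_eq_map, Measure.smul_apply,
    Measure.map_apply continuous_anglesPlane.measurable hm, huniv, smul_eq_mul, mul_eq_zero] at h0
  rcases h0 with h0 | h0
  · rw [ENNReal.ofReal_eq_zero] at h0
    have : 0 < (2 * π)⁻¹ := by positivity
    linarith
  · rw [show (volume : Measure (AddCircle (2 * π) × AddCircle (2 * π) × AddCircle (2 * π))) =
      (volume : Measure (AddCircle (2 * π))).prod ((volume : Measure (AddCircle (2 * π))).prod
        (volume : Measure (AddCircle (2 * π)))) from rfl, ← univ_prod_univ, Measure.prod_prod,
      ← univ_prod_univ, Measure.prod_prod] at h0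
    simp [AddCircle.measure_univ, Real.pi_pos.not_ge] at h0

/-- The bundle carries the topology of a pseudometric, so bounded continuous functions separate
finite Borel measures; hence varifold limits are unique. -/
theorem eq_of_forall_integral_eq {v w : Measure LegGr} [IsFiniteMeasure v] [IsFiniteMeasure w]
    (h : ∀ Φ : LegGr → ℝ, Continuous Φ → ∫ g, Φ g ∂v = ∫ g, Φ g ∂w) : v = w := by
  let m : PseudoMetricSpace LegGr := PseudoMetricSpace.induced
    (fun g : LegGr => ((g.pt, g.plane.starProjection) : E × (E →L[ℝ] E))) inferInstance
  exact ext_of_forall_integral_eq_of_IsFiniteMeasure fun f => h f f.continuous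

end
end HSL

theorem mainTheorem7 :
    ∃ (R : ℕ → ℝ) (u : ∀ k, HSL.Torus (R k) → HSL.E) (v : ℕ → Measure HSL.LegGr),
      (∀ k, 0 < R k) ∧ Tendsto R atTop atTop ∧
      (∀ k, HSL.IsConformalLegendrianEmbedding (R k) (u k) ∧
        HSL.IsHamiltonianStationary (R k) (u k) ∧
        HSL.IsPHSLV (R k) (u k) (fun _ => 1) ∧
        HSL.IsInducedVarifold (R k) (u k) (fun _ => 1) (v k) ∧
        HSL.IsIntegralVarifold (v k) ∧
        HSL.IsHSLV (v k)) ∧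
      HSL.VarifoldTendsto v HSL.limitVarifold ∧
      HSL.IsHSLV HSL.limitVarifold ∧
      ¬ HSL.IsRectifiableVarifold HSL.limitVarifold ∧
      (∀ (s : ℕ → ℕ) (w : Measure HSL.LegGr), StrictMono s → IsFiniteMeasure w →
        HSL.VarifoldTendsto (fun k => v (s k)) w → ¬ HSL.IsRectifiableVarifold w) := by
  refine ⟨HSL.seqLength, fun k => HSL.legTorus (k + 1) (HSL.seqAngle k), HSL.seqVarifold,
    fun k => (HSL.isConformalParam_seq k).pos, HSL.tendsto_seqLength, fun k => ?_,
    HSL.varifoldTendsto_seqVarifold, HSL.isHSLV_limitVarifold,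
    HSL.not_isRectifiableVarifold_limitVarifold, fun s w hs hw hlim => ?_⟩
  · have h := HSL.isConformalParam_seq k
    exact ⟨HSL.isConformalLegendrianEmbedding_legTorus h, HSL.isHamiltonianStationary_legTorus h,
      HSL.isPHSLV_legTorus h, HSL.isInducedVarifold_legTorus h,
      HSL.isIntegralVarifold_torusVarifold h, HSL.isHSLV_torusVarifold h⟩
  · have := HSL.isFiniteMeasure_limitVarifold
    have hw : w = HSL.limitVarifold := HSL.eq_of_forall_integral_eq fun Φ hΦ =>
      tendsto_nhds_unique (hlim Φ hΦ)
        ((HSL.varifoldTendsto_seqVarifold Φ hΦ).comp hs.tendsto_atTop)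
    rw [hw]
    exact HSL.not_isRectifiableVarifold_limitVarifold
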